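/- For a bit string $x\in\{0,1\}^*$ let $b(x)$ be its length. Consider functions $f:\{0,1\}^*\to\mathbb{Q}$ such that the number of bits needed to write $f(x)$ is bounded by a polynomial in $b(x)$, and let $\eta:\mathbb{N}\to\mathbb{R}^+$. (Computable.) $f$ is classical (quantum) $\eta$-computable, written $f\in\mathcal{P}_C^{\,\eta}$ ($f\in\mathcal{P}_Q^{\,\eta}$), if there are a polynomial-time classical randomized (quantum) algorithm and constants $c>0$ and $\delta\in[0,\frac12)$ such that for every input $x\in\{0,1\}^*$ the output $\hat f(x)\in\mathbb{Q}$ satisfies $$\mathrm{Prob}\left(|\hat f(x)-f(x)|<c\,\eta(b(x))\right)>1-\delta .$$ (Learnable.) $f$ is classical (quantum) $\eta$-learnable, written $f\in\mathcal{L}_C^{\,\eta}$ ($f\in\mathcal{L}_Q^{\,\eta}$), if there are a classical randomized (quantum) procedure running in time polynomial in the size of its input, a sequence of probability distributions $(D_m)_{m\ge1}$ with $\mathrm{supp}(D_m)=\{x\in\{0,1\}^*: b(x)\le m\}$, a polynomial $p$, and constants $c>0$ and $\delta\in[0,\frac12)$ such that for every $m\ge1$ and every $x\in\mathrm{supp}(D_m)$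 the procedure, given $x$ and a training set $\{(x_i,f(x_i))\}_{i=1}^{p(m)}$ with $x_1,\dots,x_{p(m)}$ independent and distributed according to $D_m$, outputs an estimate $\hat f(x)\in\mathbb{Q}$ with $$\mathrm{Prob}\left(|\hat f(x)-f(x)|<c\,\eta(m)\right)>1-\delta ,$$ where the probability is over the training set and the procedure. Claim: if $\mathbf{BQP}\neq\mathbf{BPP}$ (as classes of languages), then, for the constant function $\eta=1$, the set of functions with a quantum learning speed-up differs from the set of functions with a quantum computational speed-up: $$\mathcal{L}_Q^{\,1}\setminus\mathcal{L}_C^{\,1}\;\neq\;\mathcal{P}_Q^{\,1}\setminus\mathcal{P}_C^{\,1}.$$ -/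

import Mathlib

/-! ## Encoding finite objects as bit strings -/

/-- A self-delimiting (prefix-free, hence injective) encoding of the elements of `α` as bit
strings. Because the codes are self-delimiting, pairs and lists are encoded by concatenation. -/
class BitCode (α : Type) where
  enc : α → List Bool
  cancel : ∀ a b : α, ∀ s t : List Bool, enc a ++ s = enc b ++ t → a = b ∧ s = t

/-- The number of bits of the encoding of `a`. -/
def codeSize {α : Type} [BitCode α] (a : α) : ℕ := (BitCode.enc a).length

/-- Encode the elements of `α` through an injective representation in `β`. -/
@[reducible] def BitCode.ofInjective {α β : Type} [BitCode β] (r : α → β)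
    (hr : Function.Injective r) : BitCode α where
  enc a := BitCode.enc (r a)
  cancel a b s t h := by
    obtain ⟨h1, h2⟩ := BitCode.cancel (r a) (r b) s t h
    exact ⟨hr h1, h2⟩

instance instBitCodeUnit : BitCode Unit where
  enc _ := []
  cancel _ _ _ _ h := ⟨rfl, h⟩

instance instBitCodeBool : BitCode Bool where
  enc b := [b]
  cancel _ _ _ _ h := by simpa using h

instance instBitCodeProd {α β : Type} [BitCode α] [BitCode β] : BitCode (α × β) where
  enc a := BitCode.enc a.1 ++ BitCode.enc a.2
  cancel a b s t h := by
    rw [List.append_assoc, List.append_assoc] at h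
    obtain ⟨h1, h2⟩ := BitCode.cancel _ _ _ _ h
    obtain ⟨h3, h4⟩ := BitCode.cancel _ _ _ _ h2
    exact ⟨Prod.ext h1 h3, h4⟩

/-- Each element of a list is announced by the bit `1`; the bit `0` ends the list. -/
def encList {α : Type} [BitCode α] : List α → List Bool
  | [] => [false]
  | a :: l => true :: (BitCode.enc a ++ encList l)

theorem encList_cancel {α : Type} [BitCode α] (a : List α) :
    ∀ (b : List α) (s t : List Bool), encList a ++ s = encList b ++ t → a = b ∧ s = t := by
  induction a with
  | nil =>
    intro b s t h
    cases b with
    | nil => simpa [encList] using h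
    | cons b bs => simp [encList] at h
  | cons a as ih =>
    intro b s t h
    cases b with
    | nil => simp [encList] at h
    | cons b bs =>
      simp only [encList, List.cons_append, List.append_assoc, List.cons.injEq, true_and] at h
      obtain ⟨h1, h2⟩ := BitCode.cancel _ _ _ _ h
      obtain ⟨h3, h4⟩ := ih _ _ _ h2
      exact ⟨by rw [h1, h3], h4⟩

instance instBitCodeList {α : Type} [BitCode α] : BitCode (List α) where
  enc := encList
  cancel := encList_cancel

/-- Natural numbers are written in binary. -/
instance instBitCodeNat : BitCode ℕ :=
  BitCode.ofInjective Nat.bits (fun a b h => by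
    have := congrArg (fun l => List.foldr Nat.bit 0 l) h
    have key : ∀ n : ℕ, List.foldr Nat.bit 0 n.bits = n := by
      intro n
      induction n using Nat.binaryRec' with
      | zero => simp
      | bit b n hb ih => rw [Nat.bits_append_bit n b hb]; simp [ih]
    simpa [key] using this)

/-- Integers: sign and absolute value. -/
instance instBitCodeInt : BitCode ℤ :=
  BitCode.ofInjective (fun z : ℤ => (decide (z < 0), z.natAbs)) (fun a b h => by
    simp only [Prod.mk.injEq, decide_eq_decide] at h
    omega)

/-- Rationals: numerator and denominator in lowest terms. -/
instance instBitCodeRat : BitCode ℚ :=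
  BitCode.ofInjective (fun y : ℚ => (y.num, y.den)) (fun a b h => by
    simp only [Prod.mk.injEq] at h
    exact Rat.ext h.1 h.2)

/-! ## A deterministic machine model with a step count

Programs act on finitely many stacks of bits (a Turing machine tape is a pair of stacks). Pushing
or popping one bit, and testing the top of one stack, costs one step. -/

/-- Contents of the stacks. -/
abbrev Store : Type := ℕ → List Bool

/-- Programs of the stack machine. -/
inductive Prog : Type
  /-- push the bit `b` on stack `v` -/
  | push (v : ℕ) (b : Bool) : Prog
  /-- remove the top bit of stack `v` (no effect if it is empty) -/
  | pop (v : ℕ) : Prog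
  /-- run the first program, then the second one -/
  | seq (p q : Prog) : Prog
  /-- run `p`, `q` or `r` when stack `v` is empty, has top bit `0`, has top bit `1` -/
  | branch (v : ℕ) (p q r : Prog) : Prog
  /-- run `p` again and again as long as stack `v` is not empty -/
  | loop (v : ℕ) (p : Prog) : Prog

/-- `Exec p s s' t`: program `p`, started in store `s`, halts in store `s'` after exactly `t`
steps. -/
inductive Exec : Prog → Store → Store → ℕ → Prop
  | push (v : ℕ) (b : Bool) (s : Store) :
      Exec (Prog.push v b) s (Function.update s v (b :: s v)) 1
  | pop (v : ℕ) (s : Store) :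
      Exec (Prog.pop v) s (Function.update s v (s v).tail) 1
  | seq {p q : Prog} {s s' s'' : Store} {t t' : ℕ} :
      Exec p s s' t → Exec q s' s'' t' → Exec (Prog.seq p q) s s'' (t + t')
  | branch_empty {v : ℕ} {p q r : Prog} {s s' : Store} {t : ℕ} :
      s v = [] → Exec p s s' t → Exec (Prog.branch v p q r) s s' (t + 1)
  | branch_zero {v : ℕ} {p q r : Prog} {s s' : Store} {t : ℕ} :
      (s v).head? = some false → Exec q s s' t → Exec (Prog.branch v p q r) s s' (t + 1)
  | branch_one {v : ℕ} {p q r : Prog} {s s' : Store} {t : ℕ} :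
      (s v).head? = some true → Exec r s s' t → Exec (Prog.branch v p q r) s s' (t + 1)
  | loop_stop {v : ℕ} {p : Prog} {s : Store} :
      s v = [] → Exec (Prog.loop v p) s s 1
  | loop_step {v : ℕ} {p : Prog} {s s' s'' : Store} {t t' : ℕ} :
      s v ≠ [] → Exec p s s' t → Exec (Prog.loop v p) s' s'' t' →
        Exec (Prog.loop v p) s s'' (t + t' + 1)

/-- The initial store: the input is on stack `0`, all other stacks are empty. -/
def initStore (w : List Bool) : Store := Function.update (fun _ => []) 0 w

/-- `g` is computable in deterministic polynomial time: some program, started with the code of `a`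
on stack `0`, halts with the code of `g a` on stack `0`, within a number of steps that is polynomial
in the length of the code of `a`. -/
def PolyTime {α β : Type} [BitCode α] [BitCode β] (g : α → β) : Prop :=
  ∃ (p : Prog) (P : Polynomial ℕ), ∀ a : α, ∃ (s : Store) (t : ℕ),
    Exec p (initStore (BitCode.enc a)) s t ∧ s 0 = BitCode.enc (g a) ∧ t ≤ P.eval (codeSize a)

/-! ## Quantum circuits -/

/-- Gates on `n` qubits: Hadamard, `T` (the `π/8` gate), and controlled not. -/
inductive Gate (n : ℕ) : Type
  | H (i : Fin n) : Gate n
  | T (i : Fin n) : Gate n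
  | CNOT (c t : Fin n) (h : c ≠ t) : Gate n

/-- Amplitudes of an `n`-qubit state in the computational basis. -/
abbrev QState (n : ℕ) : Type := (Fin n → Bool) → ℂ

/-- The action of a gate on a state:
`H|b⟩ = (|0⟩ + (-1)^b |1⟩)/√2`, `T|b⟩ = exp(iπb/4)|b⟩`, `CNOT|c,t⟩ = |c, t ⊕ c⟩`. -/
noncomputable def Gate.act {n : ℕ} : Gate n → QState n → QState n
  | Gate.H i, ψ => fun x =>
      (ψ (Function.update x i false) + (if x i then -1 else 1) * ψ (Function.update x i true))
        / (Real.sqrt 2 : ℂ)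
  | Gate.T i, ψ => fun x =>
      (if x i then Complex.exp (((Real.pi / 4 : ℝ) : ℂ) * Complex.I) else 1) * ψ x
  | Gate.CNOT c t _, ψ => fun x => ψ (Function.update x t (xor (x t) (x c)))

/-- A quantum circuit: a number of qubits and a list of gates, applied from left to right. -/
structure Circuit : Type where
  width : ℕ
  gates : List (Gate width)

/-- The state `|0…0⟩`. -/
noncomputable def zeroState (n : ℕ) : QState n := fun x => if x = fun _ => false then 1 else 0

/-- The state produced by the circuit from `|0…0⟩`. -/
noncomputable def Circuit.finalState (C : Circuit) : QState C.width :=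
  C.gates.foldl (fun ψ g => g.act ψ) (zeroState C.width)

theorem Gate.sum_act {n : ℕ} (g : Gate n) (ψ : QState n) :
    ∑ x, ‖g.act ψ x‖ ^ 2 = ∑ x, ‖ψ x‖ ^ 2 := by
  cases g with
  | H i =>
    let flip : (Fin n → Bool) → (Fin n → Bool) := fun x => Function.update x i (!(x i))
    have hflip : Function.Involutive flip := by intro x; simp [flip]
    have hs : ∀ F : (Fin n → Bool) → ℝ, 2 * ∑ x, F x = ∑ x, (F x + F (flip x)) := by
      intro F
      rw [Finset.sum_add_distrib, two_mul]
      congr 1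
      exact (Equiv.sum_comp hflip.toPerm F).symm
    have par : ∀ a b : ℂ, ‖(a + b) / (Real.sqrt 2 : ℂ)‖ ^ 2 + ‖(a - b) / (Real.sqrt 2 : ℂ)‖ ^ 2
        = ‖a‖ ^ 2 + ‖b‖ ^ 2 := by
      intro a b
      have h2 : ‖(Real.sqrt 2 : ℂ)‖ ^ 2 = 2 := by
        rw [Complex.norm_real, Real.norm_eq_abs, sq_abs, Real.sq_sqrt (by norm_num)]
      have := parallelogram_law_with_norm ℝ a b
      rw [norm_div, norm_div, div_pow, div_pow, h2]
      nlinarith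
    have key : 2 * ∑ x, ‖(Gate.H i).act ψ x‖ ^ 2 = 2 * ∑ x, ‖ψ x‖ ^ 2 := by
      rw [hs, hs]
      refine Finset.sum_congr rfl fun x _ => ?_
      have hx : x = Function.update x i (x i) := by simp
      have e := par (ψ (Function.update x i false)) (ψ (Function.update x i true))
      cases hxi : x i <;> rw [hxi] at hx
      · simp only [Gate.act, flip, hxi, Function.update_self, Function.update_idem]
        simp only [Bool.not_false, if_true, one_mul, neg_mul, ← sub_eq_add_neg,
          Bool.false_eq_true, if_false]
        rw [e, ← hx]
      · simp only [Gate.act, flip, hxi, Function.update_self, Function.update_idem]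
        simp only [Bool.not_true, if_true, one_mul, neg_mul, ← sub_eq_add_neg,
          Bool.false_eq_true, if_false]
        rw [add_comm, e, ← hx, add_comm]
    linarith
  | T i =>
    refine Finset.sum_congr rfl fun x _ => ?_
    simp only [Gate.act, norm_mul]
    split_ifs
    · rw [Complex.norm_exp_ofReal_mul_I, one_mul]
    · simp
  | CNOT c t h =>
    have hinv : Function.Involutive
        (fun x : Fin n → Bool => Function.update x t (xor (x t) (x c))) := by
      intro x
      simp [Function.update_of_ne h]
    exact Equiv.sum_comp hinv.toPerm (fun x => ‖ψ x‖ ^ 2)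

theorem Circuit.sum_finalState (C : Circuit) : ∑ x, ‖C.finalState x‖ ^ 2 = 1 := by
  have aux : ∀ (l : List (Gate C.width)) (ψ : QState C.width),
      ∑ x, ‖l.foldl (fun ψ g => g.act ψ) ψ x‖ ^ 2 = ∑ x, ‖ψ x‖ ^ 2 := by
    intro l
    induction l with
    | nil => intro ψ; rfl
    | cons g l ih => intro ψ; rw [List.foldl_cons, ih, Gate.sum_act]
  rw [Circuit.finalState, aux]
  rw [Finset.sum_eq_single (fun _ => false)]
  · simp [zeroState]
  · intro b _ hb
    simp [zeroState, hb]
  · simp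

/-- The outcome of measuring all qubits in the computational basis after running the circuit on
`|0…0⟩` (Born rule). -/
noncomputable def Circuit.measure (C : Circuit) : PMF (Fin C.width → Bool) :=
  PMF.ofFintype (fun x => ENNReal.ofReal (‖C.finalState x‖ ^ 2)) (by
    rw [← ENNReal.ofReal_sum_of_nonneg (fun _ _ => by positivity), C.sum_finalState,
      ENNReal.ofReal_one])

/-- A gate as its type (two bits) and the qubits it acts on (indices in unary). -/
def Gate.data {n : ℕ} : Gate n → (Bool × Bool) × (List Unit × List Unit)
  | Gate.H i => ((false, false), (List.replicate i (), []))
  | Gate.T i => ((false, true), (List.replicate i (), []))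
  | Gate.CNOT c t _ => ((true, false), (List.replicate c (), List.replicate t ()))

theorem Gate.data_injective (n : ℕ) : Function.Injective (Gate.data (n := n)) := by
  have rep : ∀ i j : Fin n, List.replicate (i : ℕ) () = List.replicate (j : ℕ) () → i = j := by
    intro i j h
    have := congrArg List.length h
    simp only [List.length_replicate] at this
    exact Fin.ext this
  intro a b h
  cases a <;> cases b <;> simp only [Gate.data, Prod.mk.injEq] at h <;> simp at h
  · rw [Fin.ext h]
  · rw [Fin.ext h]
  · obtain ⟨h1, h2⟩ := h
    have h1 := Fin.ext h1
    have h2 := Fin.ext h2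
    subst h1 h2
    rfl

/-- A circuit is described by its number of qubits, in unary, and the list of its gates. -/
def Circuit.data (C : Circuit) : List Unit × List ((Bool × Bool) × (List Unit × List Unit)) :=
  (List.replicate C.width (), C.gates.map Gate.data)

theorem Circuit.data_injective : Function.Injective Circuit.data := by
  rintro ⟨n, l⟩ ⟨n', l'⟩ h
  simp only [Circuit.data, Prod.mk.injEq] at h
  obtain ⟨h1, h2⟩ := h
  have h1 := congrArg List.length h1
  simp only [List.length_replicate] at h1
  subst h1
  rw [List.map_injective_iff.mpr (Gate.data_injective n) h2]

instance instBitCodeCircuit : BitCode Circuit :=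
  BitCode.ofInjective Circuit.data Circuit.data_injective

/-! ## Efficient randomized and quantum algorithms

An algorithm is viewed as the map that sends an input to the law of its output. -/

/-- Efficient classical (randomized) algorithms: a deterministic polynomial-time computation on the
input and a polynomial number of independent fair coin tosses. -/
def IsClassicalAlgorithm {α β : Type} [BitCode α] [BitCode β] (A : α → PMF β) : Prop :=
  ∃ (q : Polynomial ℕ) (g : α × List Bool → β), PolyTime g ∧
    ∀ a, A a = (PMF.uniformOfFintype (Fin (q.eval (codeSize a)) → Bool)).map
      (fun r => g (a, List.ofFn r))

/-- Efficient quantum algorithms: in deterministic polynomial time a quantum circuit is produced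
from the input (uniformity); it is run on `|0…0⟩` and measured, and the output is computed in
deterministic polynomial time from the input and the measured bits. -/
def IsQuantumAlgorithm {α β : Type} [BitCode α] [BitCode β] (A : α → PMF β) : Prop :=
  ∃ (C : α → Circuit) (g : α × List Bool → β), PolyTime C ∧ PolyTime g ∧
    ∀ a, A a = (C a).measure.map (fun r => g (a, List.ofFn r))

/-- The probability that an outcome with law `A` lies in `S`. -/
noncomputable def prob {β : Type} (A : PMF β) (S : Set β) : ℝ := (A.toOuterMeasure S).toReal

/-- `A` decides the language `L` with error probability bounded away from `1/2`. -/
def DecidesWithBoundedError (A : List Bool → PMF Bool) (L : Language Bool) : Prop :=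
  ∃ δ : ℝ, δ < 1 / 2 ∧ ∀ x : List Bool, 1 - δ ≤ prob (A x) {b | b = true ↔ x ∈ L}

/-- Bounded-error probabilistic polynomial time. -/
def BPP : Set (Language Bool) :=
  {L | ∃ A : List Bool → PMF Bool, IsClassicalAlgorithm A ∧ DecidesWithBoundedError A L}

/-- Bounded-error quantum polynomial time. -/
def BQP : Set (Language Bool) :=
  {L | ∃ A : List Bool → PMF Bool, IsQuantumAlgorithm A ∧ DecidesWithBoundedError A L}

/-! ## Computable and learnable functions -/

/-- The functions under consideration: defined on the binary strings, with values that can be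
written down with polynomially many bits. -/
def TargetFunctions : Set (List Bool → ℚ) :=
  {f | ∃ P : Polynomial ℕ, ∀ x : List Bool, codeSize (f x) ≤ P.eval x.length}

/-- `A` estimates `f` with error `O(η)`: there are `c > 0` and `0 ≤ δ < 1/2` such that, for every
`x`, the error is less than `c η(b(x))` with probability greater than `1 - δ`, where `b(x)` is the
length of `x`. -/
def Estimates (A : List Bool → PMF ℚ) (η : ℕ → ℝ) (f : List Bool → ℚ) : Prop :=
  ∃ c δ : ℝ, 0 < c ∧ 0 ≤ δ ∧ δ < 1 / 2 ∧ ∀ x : List Bool,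
    1 - δ < prob (A x) {y | |(y : ℝ) - (f x : ℝ)| < c * η x.length}

/-- The classical `η`-computable functions. -/
def ClassicalComputable (η : ℕ → ℝ) : Set (List Bool → ℚ) :=
  {f ∈ TargetFunctions | ∃ A : List Bool → PMF ℚ, IsClassicalAlgorithm A ∧ Estimates A η f}

/-- The quantum `η`-computable functions. -/
def QuantumComputable (η : ℕ → ℝ) : Set (List Bool → ℚ) :=
  {f ∈ TargetFunctions | ∃ A : List Bool → PMF ℚ, IsQuantumAlgorithm A ∧ Estimates A η f}

/-- A sequence of distributions `D 1, D 2, …` such that the support of `D m` is the set of all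
binary strings of length at most `m`. -/
def IsDistributionSequence (D : ℕ → PMF (List Bool)) : Prop :=
  ∀ m : ℕ, 1 ≤ m → (D m).support = {x | x.length ≤ m}

/-- The law of a list of `n` independent samples of `D`. -/
noncomputable def iidSample (D : PMF (List Bool)) : ℕ → PMF (List (List Bool))
  | 0 => PMF.pure []
  | n + 1 => D.bind fun x => (iidSample D n).map fun l => x :: l

/-- The law of a training set `(x₁, f x₁), …, (xₙ, f xₙ)` with `x₁, …, xₙ` independent of
law `D`. -/
noncomputable def trainingSet (f : List Bool → ℚ) (D : PMF (List Bool)) (n : ℕ) :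
    PMF (List (List Bool × ℚ)) :=
  (iidSample D n).map fun l => l.map fun x => (x, f x)

/-- The procedure `M`, which maps an input `x` and a training set to (the law of) an estimate of
`f x`, learns `f` with error `O(η)` from polynomially many samples of some sequence of
distributions. The probability is taken over the training set and the procedure. -/
def Learns (M : List Bool × List (List Bool × ℚ) → PMF ℚ) (η : ℕ → ℝ) (f : List Bool → ℚ) :
    Prop :=
  ∃ (D : ℕ → PMF (List Bool)) (p : Polynomial ℕ) (c δ : ℝ),
    IsDistributionSequence D ∧ 0 < c ∧ 0 ≤ δ ∧ δ < 1 / 2 ∧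
    ∀ m : ℕ, 1 ≤ m → ∀ x ∈ (D m).support,
      1 - δ < prob ((trainingSet f (D m) (p.eval m)).bind fun T => M (x, T))
        {y | |(y : ℝ) - (f x : ℝ)| < c * η m}

/-- The classical `η`-learnable functions. -/
def ClassicalLearnable (η : ℕ → ℝ) : Set (List Bool → ℚ) :=
  {f ∈ TargetFunctions | ∃ M : List Bool × List (List Bool × ℚ) → PMF ℚ,
    IsClassicalAlgorithm M ∧ Learns M η f}

/-- The quantum `η`-learnable functions. -/
def QuantumLearnable (η : ℕ → ℝ) : Set (List Bool → ℚ) :=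
  {f ∈ TargetFunctions | ∃ M : List Bool × List (List Bool × ℚ) → PMF ℚ,
    IsQuantumAlgorithm M ∧ Learns M η f}

/-! The point is that a learner receives data that no algorithm could compute, and that learnability
lets the distributions be chosen freely, without any computability requirement. Fix a language `L`
in `BQP` but not in `BPP`; one exists because fair coins are measured Hadamard qubits, so `BPP ⊆
BQP`. Assume that the two sets of functions are equal.

An additive error of order one is made harmless by amplification: on a string `1^j 0 y`,
`gapFunction L` is `4^j` or `2^j` according to whether `y ∈ L`, so a constant `j` turns any
bounded-error estimate into a decision. Two variants of this function are compared. The first,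
`taggedGap L`, ignores an extra tag bit. It is quantum computable, and a classical algorithm for it
would put `L` in `BPP` (`mem_BPP_of_taggedGap`). By the assumed equality it is therefore quantum
learnable and not classically learnable.

The second, `signedGap L h`, multiplies `gapFunction L x` by a sign `h` of the length of `x`. There
are only countably many quantum algorithms, and one algorithm can estimate `signedGap L h` only for
sign sequences that agree eventually, so some `h` makes it not quantum computable
(`exists_signedGap_notMem`). It is nevertheless quantum learnable for every `h`: polynomially many
samples contain, with high probability, one of the length of `x`, which shows the sign, and the
absolute value is found by the quantum algorithm for `L` (`signedGap_mem_quantumLearnable`).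

It remains to see that `signedGap L h` is not classically learnable. A classical learner for it
would give one for `taggedGap L` (`taggedGap_mem_classicalLearnable`): the distributions for
`taggedGap L` are chosen so that nearly all samples carry the sign `h` in their tag. The new learner
multiplies the sample values by these signs, runs the old learner and drops the sign of the result.
Hence `signedGap L h` has a quantum learning speed-up, so by the assumed equality it is quantum
computable, a contradiction.

The greater part of the file shows that the reductions involved run in polynomial time on the stack
machine. -/

/-! ## Executions of stack programs -/

namespace Prog

/-- Rename the stacks of a program. -/
def map (σ : ℕ → ℕ) : Prog → Prog
  | push v b => push (σ v) b
  | pop v => pop (σ v)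
  | seq p q => seq (p.map σ) (q.map σ)
  | branch v p q r => branch (σ v) (p.map σ) (q.map σ) (r.map σ)
  | loop v p => loop (σ v) (p.map σ)

/-- A strict upper bound of the stacks used by a program. -/
def bound : Prog → ℕ
  | push v _ => v + 1
  | pop v => v + 1
  | seq p q => max p.bound q.bound
  | branch v p q r => max (v + 1) (max p.bound (max q.bound r.bound))
  | loop v p => max (v + 1) p.bound

/-- A program without effect. -/
def skip : Prog := seq (push 0 true) (pop 0)

/-- Empty the stack `v`. -/
def clear (v : ℕ) : Prog := loop v (pop v)

/-- Empty the stacks `1, …, k`. -/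
def clearUpTo : ℕ → Prog
  | 0 => skip
  | k + 1 => seq (clearUpTo k) (clear (k + 1))

/-- Move the bits of stack `u` to stack `v`, reversing their order. -/
def move (u v : ℕ) : Prog :=
  loop u (branch u skip (seq (pop u) (push v false)) (seq (pop u) (push v true)))

/-- Move the bits of stack `u` to the stacks `v` and `w`, reversing their order. -/
def moveTwice (u v w : ℕ) : Prog :=
  loop u (branch u skip (seq (pop u) (seq (push v false) (push w false)))
    (seq (pop u) (seq (push v true) (push w true))))

/-- Push the bits of `w`, the last one first. -/
def pushAll (v : ℕ) : List Bool → Prog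
  | [] => skip
  | b :: w => seq (pushAll v w) (push v b)

end Prog

namespace Exec

/-- Determinism is what makes a program compute at most one function, and so makes the
polynomial-time functions countable. -/
theorem deterministic {p : Prog} {s s₁ s₂ : Store} {t₁ t₂ : ℕ} (h₁ : Exec p s s₁ t₁)
    (h₂ : Exec p s s₂ t₂) : s₁ = s₂ ∧ t₁ = t₂ := by
  induction h₁ generalizing s₂ t₂ with
  | push v b s => cases h₂; exact ⟨rfl, rfl⟩
  | pop v s => cases h₂; exact ⟨rfl, rfl⟩
  | seq _ _ ih1 ih2 =>
    cases h₂ with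
    | seq a b =>
      obtain ⟨rfl, rfl⟩ := ih1 a
      obtain ⟨rfl, rfl⟩ := ih2 b
      exact ⟨rfl, rfl⟩
  | branch_empty h _ ih =>
    cases h₂ with
    | branch_empty _ a => obtain ⟨rfl, rfl⟩ := ih a; exact ⟨rfl, rfl⟩
    | branch_zero h' _ => simp [h] at h'
    | branch_one h' _ => simp [h] at h'
  | branch_zero h _ ih =>
    cases h₂ with
    | branch_empty h' a => simp [h'] at h
    | branch_zero _ a => obtain ⟨rfl, rfl⟩ := ih a; exact ⟨rfl, rfl⟩
    | branch_one h' _ => simp [h] at h'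
  | branch_one h _ ih =>
    cases h₂ with
    | branch_empty h' a => simp [h'] at h
    | branch_zero h' a => simp [h] at h'
    | branch_one _ a => obtain ⟨rfl, rfl⟩ := ih a; exact ⟨rfl, rfl⟩
  | loop_stop h =>
    cases h₂ with
    | loop_stop _ => exact ⟨rfl, rfl⟩
    | loop_step h' _ _ => exact absurd h h'
  | loop_step h _ _ ih1 ih2 =>
    cases h₂ with
    | loop_stop h' => exact absurd h' h
    | loop_step _ a b =>
      obtain ⟨rfl, rfl⟩ := ih1 a
      obtain ⟨rfl, rfl⟩ := ih2 b
      exact ⟨rfl, rfl⟩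

theorem extend_update {σ : ℕ → ℕ} (hσ : Function.Injective σ) (s R : Store) (v : ℕ)
    (x : List Bool) :
    Function.update (Function.extend σ s R) (σ v) x
      = Function.extend σ (Function.update s v x) R := by
  funext w
  by_cases hw : ∃ u, σ u = w
  · obtain ⟨u, rfl⟩ := hw
    rw [hσ.extend_apply]
    by_cases huv : u = v
    · subst huv; simp
    · rw [Function.update_of_ne (fun h => huv (hσ h)), hσ.extend_apply,
        Function.update_of_ne huv]
  · rw [Function.update_of_ne (fun h => hw ⟨v, h.symm⟩), Function.extend_apply' _ _ _ hw,
      Function.extend_apply' _ _ _ hw]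

/-- The stacks outside the range of `σ` hold arbitrary data `R` and are untouched; this is how a
program runs as a subroutine next to saved data. -/
theorem map {σ : ℕ → ℕ} (hσ : Function.Injective σ) (R : Store) {p : Prog} {s s' : Store}
    {t : ℕ} (h : Exec p s s' t) :
    Exec (p.map σ) (Function.extend σ s R) (Function.extend σ s' R) t := by
  induction h with
  | push v b s =>
    rw [← extend_update hσ]
    have := Exec.push (σ v) b (Function.extend σ s R)
    rwa [hσ.extend_apply] at this
  | pop v s =>
    rw [← extend_update hσ]
    have := Exec.pop (σ v) (Function.extend σ s R)
    rwa [hσ.extend_apply] at this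
  | seq _ _ ih1 ih2 => exact ih1.seq ih2
  | branch_empty h _ ih => exact .branch_empty (by rwa [hσ.extend_apply]) ih
  | branch_zero h _ ih => exact .branch_zero (by rwa [hσ.extend_apply]) ih
  | branch_one h _ ih => exact .branch_one (by rwa [hσ.extend_apply]) ih
  | loop_stop h => exact Exec.loop_stop (by rwa [hσ.extend_apply])
  | loop_step h _ _ ih1 ih2 => exact .loop_step (by rwa [hσ.extend_apply]) ih1 ih2

/-- Together with `length_le` this makes it possible to clean up after a program: finitely many
stacks need emptying, and their lengths are bounded by the initial lengths plus the running time. -/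
theorem frame {p : Prog} {s s' : Store} {t : ℕ} (h : Exec p s s' t) :
    ∀ v, p.bound ≤ v → s' v = s v := by
  induction h with
  | push u b s =>
    intro v hv
    simp only [Prog.bound] at hv
    exact Function.update_of_ne (by omega) _ _
  | pop u s =>
    intro v hv
    simp only [Prog.bound] at hv
    exact Function.update_of_ne (by omega) _ _
  | seq _ _ ih1 ih2 =>
    intro v hv
    simp only [Prog.bound] at hv
    rw [ih2 v (by omega), ih1 v (by omega)]
  | branch_empty _ _ ih | branch_zero _ _ ih | branch_one _ _ ih =>
    intro v hv
    simp only [Prog.bound] at hv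
    exact ih v (by omega)
  | loop_stop _ => intro v _; rfl
  | loop_step _ _ _ ih1 ih2 =>
    intro v hv
    rw [ih2 v hv]
    simp only [Prog.bound] at hv
    exact ih1 v (by omega)

theorem length_le {p : Prog} {s s' : Store} {t : ℕ} (h : Exec p s s' t) :
    ∀ v, (s' v).length ≤ (s v).length + t := by
  induction h with
  | push u b s =>
    intro v
    by_cases hv : v = u
    · subst hv; simp
    · rw [Function.update_of_ne hv]; omega
  | pop u s =>
    intro v
    by_cases hv : v = u
    · subst hv; simp; omega
    · rw [Function.update_of_ne hv]; omega
  | seq _ _ ih1 ih2 => intro v; have := ih1 v; have := ih2 v; omega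
  | branch_empty _ _ ih | branch_zero _ _ ih | branch_one _ _ ih =>
    intro v; have := ih v; omega
  | loop_stop _ => intro v; omega
  | loop_step _ _ _ ih1 ih2 => intro v; have := ih1 v; have := ih2 v; omega

end Exec

/-- The store with the given stacks, all others being empty. -/
def st (l : List (List Bool)) : Store := fun v => l.getD v []

/-- Replace the stack `n`. -/
def setAt : List (List Bool) → ℕ → List Bool → List (List Bool)
  | [], 0, x => [x]
  | [], n + 1, x => [] :: setAt [] n x
  | _ :: l, 0, x => x :: l
  | a :: l, n + 1, x => a :: setAt l n x

theorem update_st (l : List (List Bool)) (n : ℕ) (x : List Bool) :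
    Function.update (st l) n x = st (setAt l n x) := by
  have key : ∀ v, Function.update (st l) n x v = st (setAt l n x) v := by
    induction n generalizing l with
    | zero =>
      intro v
      cases l <;> cases v <;> simp [st, setAt]
    | succ n ih =>
      intro v
      cases l with
      | nil =>
        cases v with
        | zero => simp [st, setAt]
        | succ v =>
          have := ih [] v
          simp only [st, setAt, List.getD_cons_succ] at this ⊢
          rw [← this]
          by_cases h : v = n
          · subst h; simp
          · rw [Function.update_of_ne h, Function.update_of_ne (by omega)]; rfl
      | cons a l =>
        cases v with
        | zero => simp [st, setAt]
        | succ v =>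
          have := ih l v
          simp only [st, setAt, List.getD_cons_succ] at this ⊢
          rw [← this]
          by_cases h : v = n
          · subst h; simp
          · rw [Function.update_of_ne h, Function.update_of_ne (by omega)]; rfl
  exact funext key

theorem st_append_nil (l : List (List Bool)) : st (l ++ [[]]) = st l := by
  funext v
  simp only [st, List.getD_eq_getElem?_getD]
  rcases lt_trichotomy v l.length with h | h | h
  · rw [List.getElem?_append_left h]
  · subst h; simp
  · rw [List.getElem?_eq_none (by simp; omega), List.getElem?_eq_none (by omega)]

theorem initStore_eq (w : List Bool) : initStore w = st [w] := by
  have : (fun _ => [] : Store) = st [] := by funext v; simp [st]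
  rw [initStore, this, update_st]
  rfl

/-- `Runs p s s' T`: started in `s`, the program `p` halts in `s'` within `T` steps. -/
def Runs (p : Prog) (s s' : Store) (T : ℕ) : Prop := ∃ t ≤ T, Exec p s s' t

namespace Runs

theorem mono {p : Prog} {s s' : Store} {T T' : ℕ} (h : Runs p s s' T) (hT : T ≤ T') :
    Runs p s s' T' := by
  obtain ⟨t, ht, e⟩ := h
  exact ⟨t, ht.trans hT, e⟩

theorem seq {p q : Prog} {s s' s'' : Store} {T T' : ℕ} (h : Runs p s s' T)
    (h' : Runs q s' s'' T') : Runs (.seq p q) s s'' (T + T') := by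
  obtain ⟨t, ht, e⟩ := h
  obtain ⟨t', ht', e'⟩ := h'
  exact ⟨t + t', by omega, e.seq e'⟩

theorem push (v : ℕ) (b : Bool) (l : List (List Bool)) :
    Runs (.push v b) (st l) (st (setAt l v (b :: l.getD v []))) 1 := by
  refine ⟨1, le_rfl, ?_⟩
  rw [← update_st]
  exact .push v b (st l)

theorem pop (v : ℕ) (l : List (List Bool)) :
    Runs (.pop v) (st l) (st (setAt l v (l.getD v []).tail)) 1 := by
  refine ⟨1, le_rfl, ?_⟩
  rw [← update_st]
  exact .pop v (st l)

theorem skip (s : Store) : Runs Prog.skip s s 2 := by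
  refine ⟨2, le_rfl, ?_⟩
  have h := Exec.pop 0 (Function.update s 0 (true :: s 0))
  simp only [Function.update_self, List.tail_cons, Function.update_idem,
    Function.update_eq_self] at h
  exact (Exec.push 0 true s).seq h

theorem branch_cons {v : ℕ} {p q r : Prog} {s s' : Store} {T : ℕ} {b : Bool} {w : List Bool}
    (hv : s v = b :: w) (h : Runs (if b then r else q) s s' T) :
    Runs (.branch v p q r) s s' (T + 1) := by
  obtain ⟨t, ht, e⟩ := h
  cases b
  · exact ⟨t + 1, by omega, .branch_zero (by simp [hv]) e⟩
  · exact ⟨t + 1, by omega, .branch_one (by simp [hv]) e⟩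

theorem loop_stop {v : ℕ} {p : Prog} {s : Store} (hv : s v = []) : Runs (.loop v p) s s 1 :=
  ⟨1, le_rfl, Exec.loop_stop hv⟩

theorem loop_step {v : ℕ} {p : Prog} {s s' s'' : Store} {T T' : ℕ} (hv : s v ≠ [])
    (h : Runs p s s' T) (h' : Runs (.loop v p) s' s'' T') :
    Runs (.loop v p) s s'' (T + T' + 1) := by
  obtain ⟨t, ht, e⟩ := h
  obtain ⟨t', ht', e'⟩ := h'
  exact ⟨t + t' + 1, by omega, .loop_step hv e e'⟩

theorem map {σ : ℕ → ℕ} (hσ : Function.Injective σ) (R : Store) {p : Prog} {s s' : Store}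
    {T : ℕ} (h : Runs p s s' T) :
    Runs (p.map σ) (Function.extend σ s R) (Function.extend σ s' R) T := by
  obtain ⟨t, ht, e⟩ := h
  exact ⟨t, ht, e.map hσ R⟩

theorem extend_shift (l₀ l : List (List Bool)) :
    Function.extend (fun v => v + l₀.length) (st l) (st l₀) = st (l₀ ++ l) := by
  have hσ : Function.Injective (fun v => v + l₀.length) := fun a b h => by simpa using h
  funext v
  by_cases hv : l₀.length ≤ v
  · obtain ⟨u, rfl⟩ := Nat.exists_eq_add_of_le' hv
    rw [hσ.extend_apply]
    simp [st, List.getD_eq_getElem?_getD, List.getElem?_append_right]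
  · rw [Function.extend_apply' _ _ _ (by rintro ⟨u, rfl⟩; simp at hv)]
    simp [st, List.getD_eq_getElem?_getD, List.getElem?_append_left (not_le.mp hv)]

/-- Run a program on the top stacks, leaving the stacks below as they are. -/
theorem shift (l₀ : List (List Bool)) {p : Prog} {l l' : List (List Bool)} {T : ℕ}
    (h : Runs p (st l) (st l') T) :
    Runs (p.map (fun v => v + l₀.length)) (st (l₀ ++ l)) (st (l₀ ++ l')) T := by
  have hσ : Function.Injective (fun v => v + l₀.length) := fun a b h => by simpa using h
  have := h.map hσ (st l₀)
  rwa [extend_shift, extend_shift] at this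

theorem clear (v : ℕ) (s : Store) :
    Runs (Prog.clear v) s (Function.update s v []) (2 * (s v).length + 1) := by
  generalize hw : s v = w
  induction w generalizing s with
  | nil =>
    rw [← hw, Function.update_eq_self]
    exact (loop_stop hw).mono (by omega)
  | cons b w ih =>
    have h1 : Runs (.pop v) s (Function.update s v (s v).tail) 1 := ⟨1, le_rfl, .pop v s⟩
    have h2 := ih (Function.update s v (s v).tail) (by simp [hw])
    rw [Function.update_idem] at h2
    refine (loop_step (by simp [hw]) h1 h2).mono ?_
    simp; omega

theorem clearUpTo (k L : ℕ) (s : Store) (hs : ∀ v, (s v).length ≤ L) :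
    Runs (Prog.clearUpTo k) s (fun v => if 1 ≤ v ∧ v ≤ k then [] else s v)
      (k * (2 * L + 1) + 2) := by
  induction k with
  | zero =>
    have : (fun v => if 1 ≤ v ∧ v ≤ 0 then [] else s v) = s := by
      funext v; rw [if_neg (by omega)]
    rw [this]
    exact (skip s).mono (by omega)
  | succ k ih =>
    have h := ih.seq (clear (k + 1) _)
    have e : Function.update (fun v => if 1 ≤ v ∧ v ≤ k then [] else s v) (k + 1) [] =
        fun v => if 1 ≤ v ∧ v ≤ k + 1 then [] else s v := by
      funext v
      by_cases hv : v = k + 1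
      · subst hv; simp
      · rw [Function.update_of_ne hv]
        congr 1
        simp only [eq_iff_iff]
        omega
    rw [e] at h
    refine h.mono ?_
    have := hs (k + 1)
    rw [if_neg (by omega), add_mul]
    omega

theorem move {u v : ℕ} (huv : u ≠ v) (s : Store) :
    Runs (Prog.move u v) s
      (Function.update (Function.update s v ((s u).reverse ++ s v)) u [])
      (4 * (s u).length + 1) := by
  generalize hw : s u = w
  induction w generalizing s with
  | nil =>
    have : Function.update (Function.update s v ([].reverse ++ s v)) u [] = s := by
      funext y; by_cases h : y = u <;> [subst h; skip] <;> simp [*]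
    rw [this]
    exact (loop_stop hw).mono (by omega)
  | cons b w ih =>
    have h1 : ∀ c, Runs (.seq (.pop u) (.push v c)) s
        (Function.update (Function.update s u w) v (c :: s v)) 2 := by
      intro c
      have a1 := Exec.pop u s
      have a2 := Exec.push v c (Function.update s u (s u).tail)
      have := a1.seq a2
      rw [Function.update_of_ne (Ne.symm huv), hw, List.tail_cons] at this
      exact ⟨2, le_rfl, this⟩
    have h2 := ih (Function.update (Function.update s u w) v (b :: s v))
      (by rw [Function.update_of_ne huv, Function.update_self])
    have e : Function.update (Function.update s v ((b :: w).reverse ++ s v)) u [] =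
        Function.update (Function.update (Function.update (Function.update s u w) v (b :: s v)) v
          (w.reverse ++ Function.update (Function.update s u w) v (b :: s v) v)) u [] := by
      rw [Function.update_idem, Function.update_self, Function.update_comm huv,
        Function.update_idem]
      simp
    rw [e]
    refine (loop_step (T := 3) (by simp [hw]) (branch_cons hw ?_) h2).mono ?_
    · cases b <;> exact h1 _
    · simp; omega

theorem moveTwice {u v w : ℕ} (huv : u ≠ v) (huw : u ≠ w) (hvw : v ≠ w) (s : Store) :
    Runs (Prog.moveTwice u v w) s
      (Function.update (Function.update (Function.update s v ((s u).reverse ++ s v))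
        w ((s u).reverse ++ s w)) u [])
      (5 * (s u).length + 1) := by
  generalize hx : s u = x
  induction x generalizing s with
  | nil =>
    have : Function.update (Function.update (Function.update s v ([].reverse ++ s v))
        w ([].reverse ++ s w)) u [] = s := by
      funext y; by_cases h : y = u <;> [subst h; skip] <;> simp [*]
    rw [this]
    exact (loop_stop hx).mono (by omega)
  | cons b x ih =>
    have h1 : ∀ c, Runs (.seq (.pop u) (.seq (.push v c) (.push w c))) s
        (Function.update (Function.update (Function.update s u x) v (c :: s v)) w (c :: s w))
        3 := by
      intro c
      have a1 := Exec.pop u s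
      rw [hx, List.tail_cons] at a1
      have a2 := Exec.push v c (Function.update s u x)
      rw [Function.update_of_ne huv.symm] at a2
      have a3 := Exec.push w c (Function.update (Function.update s u x) v (c :: s v))
      rw [Function.update_of_ne hvw.symm, Function.update_of_ne huw.symm] at a3
      exact ⟨3, le_rfl, a1.seq (a2.seq a3)⟩
    have h2 := ih
      (Function.update (Function.update (Function.update s u x) v (b :: s v)) w (b :: s w))
      (by rw [Function.update_of_ne huw, Function.update_of_ne huv, Function.update_self])
    refine (loop_step (T := 4) (by simp [hx]) (branch_cons hx (s' := Function.update
      (Function.update (Function.update s u x) v (b :: s v)) w (b :: s w)) ?_)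
      (T' := 5 * x.length + 1) ?_).mono ?_
    · cases b <;> exact h1 _
    · refine cast ?_ h2
      congr 1
      funext y
      by_cases h3 : y = u
      · subst h3; simp
      by_cases h4 : y = w
      · subst h4; simp [Function.update_of_ne h3]
      by_cases h5 : y = v
      · subst h5
        simp [Function.update_of_ne h3, Function.update_of_ne h4]
      · simp [Function.update_of_ne h3, Function.update_of_ne h4, Function.update_of_ne h5]
    · simp; omega

theorem pushAll (v : ℕ) (w : List Bool) (s : Store) :
    Runs (Prog.pushAll v w) s (Function.update s v (w ++ s v)) (w.length + 2) := by
  induction w with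
  | nil => simpa [Prog.pushAll] using skip s
  | cons b w ih =>
    have h := Exec.push v b (Function.update s v (w ++ s v))
    rw [Function.update_idem, Function.update_self] at h
    refine (ih.seq ⟨1, le_rfl, h⟩).mono ?_
    rw [List.length_cons]

end Runs

open BitCode

/-! ## Closure properties of polynomial time -/


/-- `T` is bounded by a polynomial in the code length of its argument. -/
def PolyBdd {α : Type} [BitCode α] (T : α → ℕ) : Prop :=
  ∃ P : Polynomial ℕ, ∀ a, T a ≤ P.eval (codeSize a)

theorem Polynomial.eval_mono_nat (P : Polynomial ℕ) {m n : ℕ} (h : m ≤ n) :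
    P.eval m ≤ P.eval n := by
  rw [Polynomial.eval_eq_sum, Polynomial.eval_eq_sum]
  exact Finset.sum_le_sum fun i _ => Nat.mul_le_mul_left _ (Nat.pow_le_pow_left h i)

namespace PolyBdd

variable {α β γ : Type} [BitCode α] [BitCode β] [BitCode γ]

theorem of_le {T T' : α → ℕ} (h : PolyBdd T') (hT : ∀ a, T a ≤ T' a) : PolyBdd T := by
  obtain ⟨P, hP⟩ := h
  exact ⟨P, fun a => (hT a).trans (hP a)⟩

theorem const (n : ℕ) : PolyBdd (fun _ : α => n) := ⟨Polynomial.C n, fun a => by simp⟩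

theorem size : PolyBdd (fun a : α => codeSize a) := ⟨Polynomial.X, fun a => by simp⟩

theorem add {T T' : α → ℕ} (h : PolyBdd T) (h' : PolyBdd T') : PolyBdd (fun a => T a + T' a) := by
  obtain ⟨P, hP⟩ := h
  obtain ⟨P', hP'⟩ := h'
  exact ⟨P + P', fun a => by simpa using Nat.add_le_add (hP a) (hP' a)⟩

theorem mul {T T' : α → ℕ} (h : PolyBdd T) (h' : PolyBdd T') : PolyBdd (fun a => T a * T' a) := by
  obtain ⟨P, hP⟩ := h
  obtain ⟨P', hP'⟩ := h'
  exact ⟨P * P', fun a => by simpa using Nat.mul_le_mul (hP a) (hP' a)⟩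

theorem eval (P : Polynomial ℕ) {T : α → ℕ} (h : PolyBdd T) : PolyBdd (fun a => P.eval (T a)) := by
  obtain ⟨Q, hQ⟩ := h
  refine ⟨P.comp Q, fun a => ?_⟩
  rw [Polynomial.eval_comp]
  exact P.eval_mono_nat (hQ a)

theorem comp {T : β → ℕ} (h : PolyBdd T) {f : α → β} (hf : PolyBdd (fun a => codeSize (f a))) :
    PolyBdd (fun a => T (f a)) := by
  obtain ⟨P, hP⟩ := h
  exact (eval P hf).of_le fun a => hP _

end PolyBdd

/-! ### Programs that copy, exchange and join stacks. -/

theorem st_one (a : List Bool) : st [a, []] = st [a] := st_append_nil [a]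
theorem st_two (a b : List Bool) : st [a, b, []] = st [a, b] := st_append_nil [a, b]
theorem Runs.moveSt {u v : ℕ} (huv : u ≠ v) (l : List (List Bool)) :
    Runs (Prog.move u v) (st l)
      (st (setAt (setAt l v ((l.getD u []).reverse ++ l.getD v [])) u []))
      (4 * (l.getD u []).length + 1) := by
  rw [← update_st, ← update_st]
  exact Runs.move huv (st l)

theorem Runs.clearSt (v : ℕ) (l : List (List Bool)) :
    Runs (Prog.clear v) (st l) (st (setAt l v [])) (2 * (l.getD v []).length + 1) := by
  rw [← update_st]
  exact Runs.clear v (st l)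

/-- Duplicate stack `0` on stack `1`. -/
def Prog.dup : Prog := .seq (moveTwice 0 1 2) (.seq (move 1 0) (move 2 1))

theorem Runs.dup (w : List Bool) : Runs Prog.dup (st [w]) (st [w, w]) (13 * w.length + 3) := by
  have h1 : Runs (Prog.moveTwice 0 1 2) (st [w]) (st [[], w.reverse, w.reverse])
      (5 * w.length + 1) := by
    have := Runs.moveTwice (u := 0) (v := 1) (w := 2) (by simp) (by simp) (by simp) (st [w])
    simpa [update_st, setAt, st] using this
  have h2 : Runs (Prog.move 1 0) (st [[], w.reverse, w.reverse]) (st [w, [], w.reverse])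
      (4 * w.length + 1) := by
    simpa [setAt] using Runs.moveSt (u := 1) (v := 0) (by simp) [[], w.reverse, w.reverse]
  have h3 : Runs (Prog.move 2 1) (st [w, [], w.reverse]) (st [w, w])
      (4 * w.length + 1) := by
    simpa [setAt, st_two] using Runs.moveSt (u := 2) (v := 1) (by simp) [w, [], w.reverse]
  exact (h1.seq (h2.seq h3)).mono (by omega)

/-- Move stack `1` to the empty stack `0`. -/
def Prog.down : Prog := .seq (move 1 2) (move 2 0)

theorem Runs.down (w : List Bool) : Runs Prog.down (st [[], w]) (st [w]) (8 * w.length + 2) := by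
  have h1 : Runs (Prog.move 1 2) (st [[], w]) (st [[], [], w.reverse]) (4 * w.length + 1) := by
    simpa [setAt] using Runs.moveSt (u := 1) (v := 2) (by simp) [[], w]
  have h2 : Runs (Prog.move 2 0) (st [[], [], w.reverse]) (st [w]) (4 * w.length + 1) := by
    simpa [setAt, st_two, st_one] using
      Runs.moveSt (u := 2) (v := 0) (by simp) [[], [], w.reverse]
  exact (h1.seq h2).mono (by omega)

/-- Turn the stacks `f, w` into `f, [], w`, given `w, f`. -/
def Prog.swap : Prog := .seq (move 1 2) (.seq (move 0 1) (.seq (move 2 0) (move 1 2)))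

theorem Runs.swap (w x : List Bool) :
    Runs Prog.swap (st [w, x]) (st [x, [], w]) (8 * w.length + 8 * x.length + 4) := by
  have h1 : Runs (Prog.move 1 2) (st [w, x]) (st [w, [], x.reverse]) (4 * x.length + 1) := by
    simpa [setAt] using Runs.moveSt (u := 1) (v := 2) (by simp) [w, x]
  have h2 : Runs (Prog.move 0 1) (st [w, [], x.reverse]) (st [[], w.reverse, x.reverse])
      (4 * w.length + 1) := by
    simpa [setAt] using Runs.moveSt (u := 0) (v := 1) (by simp) [w, [], x.reverse]
  have h3 : Runs (Prog.move 2 0) (st [[], w.reverse, x.reverse]) (st [x, w.reverse])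
      (4 * x.length + 1) := by
    simpa [setAt, st_two] using
      Runs.moveSt (u := 2) (v := 0) (by simp) [[], w.reverse, x.reverse]
  have h4 : Runs (Prog.move 1 2) (st [x, w.reverse]) (st [x, [], w]) (4 * w.length + 1) := by
    simpa [setAt] using Runs.moveSt (u := 1) (v := 2) (by simp) [x, w.reverse]
  exact (h1.seq (h2.seq (h3.seq h4))).mono (by omega)

/-- Turn the stacks `x, [], y` into the single stack `x ++ y`. -/
def Prog.join : Prog := .seq (move 0 1) (.seq (move 1 2) (.seq (move 2 1) (move 1 0)))

theorem Runs.join (x y : List Bool) :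
    Runs Prog.join (st [x, [], y]) (st [x ++ y]) (16 * x.length + 8 * y.length + 4) := by
  have h1 : Runs (Prog.move 0 1) (st [x, [], y]) (st [[], x.reverse, y]) (4 * x.length + 1) := by
    simpa [setAt] using Runs.moveSt (u := 0) (v := 1) (by simp) [x, [], y]
  have h2 : Runs (Prog.move 1 2) (st [[], x.reverse, y]) (st [[], [], x ++ y])
      (4 * x.length + 1) := by
    simpa [setAt] using Runs.moveSt (u := 1) (v := 2) (by simp) [[], x.reverse, y]
  have h3 : Runs (Prog.move 2 1) (st [[], [], x ++ y]) (st [[], (x ++ y).reverse])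
      (4 * (x ++ y).length + 1) := by
    simpa [setAt, st_two] using Runs.moveSt (u := 2) (v := 1) (by simp) [[], [], x ++ y]
  have h4 : Runs (Prog.move 1 0) (st [[], (x ++ y).reverse]) (st [x ++ y])
      (4 * (x ++ y).length + 1) := by
    simpa [setAt, st_one, add_comm] using
      Runs.moveSt (u := 1) (v := 0) (by simp) [[], (x ++ y).reverse]
  refine (h1.seq (h2.seq (h3.seq h4))).mono ?_
  rw [List.length_append]
  omega

section
variable {α β γ : Type} [BitCode α] [BitCode β] [BitCode γ]

theorem polyTime_of_runs {f : α → β} {p : Prog} {T : α → ℕ} (hT : PolyBdd T)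
    (h : ∀ a, Runs p (st [enc a]) (st [enc (f a)]) (T a)) : PolyTime f := by
  obtain ⟨P, hP⟩ := hT
  refine ⟨p, P, fun a => ?_⟩
  obtain ⟨t, ht, e⟩ := h a
  refine ⟨st [enc (f a)], t, ?_, ?_, ht.trans (hP a)⟩
  · rw [initStore_eq]; exact e
  · simp [st]

namespace PolyTime

/-- A polynomial-time function has a program that leaves only its output. -/
theorem exists_runs {f : α → β} (h : PolyTime f) : ∃ (p : Prog) (T : α → ℕ), PolyBdd T ∧
    ∀ a, Runs p (st [enc a]) (st [enc (f a)]) (T a) := by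
  obtain ⟨p, P, hp⟩ := h
  refine ⟨.seq p (.clearUpTo p.bound),
    fun a => P.eval (codeSize a) +
      (p.bound * (2 * (codeSize a + P.eval (codeSize a)) + 1) + 2), ?_, fun a => ?_⟩
  · have hP : PolyBdd (fun a : α => P.eval (codeSize a)) := PolyBdd.eval P .size
    exact hP.add (((PolyBdd.const _).mul (((PolyBdd.const 2).mul (PolyBdd.size.add hP)).add
      (.const 1))).add (.const 2))
  · obtain ⟨s, t, e, hs, ht⟩ := hp a
    refine Runs.seq ⟨t, ht, by rw [← initStore_eq]; exact e⟩ ?_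
    -- No stack is longer than the input plus the running time, and the stacks above `p.bound` are
    -- still empty.
    have h := Runs.clearUpTo p.bound (codeSize a + P.eval (codeSize a)) s (fun v => by
      have h1 := e.length_le v
      have h2 : (initStore (enc a) v).length ≤ codeSize a := by
        rw [initStore]
        by_cases hv : v = 0
        · subst hv; simp [codeSize]
        · simp [hv]
      omega)
    convert h using 1
    funext v
    cases v with
    | zero => simp [st, hs]
    | succ v =>
      simp only [st, List.getD_cons_succ, List.getD_nil]
      split_ifs with hv
      · rfl
      · rw [e.frame (v + 1) (by omega)]
        simp [initStore]

/-- A step lengthens a stack by at most one bit. Compositions need this, since the second program is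
timed by the size of the intermediate value. -/
theorem size_bdd {f : α → β} (h : PolyTime f) : PolyBdd (fun a => codeSize (f a)) := by
  obtain ⟨p, T, hT, hp⟩ := h.exists_runs
  refine (PolyBdd.size.add hT).of_le fun a => ?_
  obtain ⟨t, ht, e⟩ := hp a
  have := e.length_le 0
  simp only [st, List.getD_cons_zero] at this
  unfold codeSize
  omega

theorem of_enc_eq {f : α → β} (h : ∀ a, enc (f a) = enc a) : PolyTime f :=
  polyTime_of_runs (p := .skip) (.const 2) fun a => by rw [h]; exact Runs.skip _

theorem congr_enc {f : α → β} {g : α → γ} (hf : PolyTime f) (h : ∀ a, enc (g a) = enc (f a)) :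
    PolyTime g := by
  obtain ⟨p, P, hp⟩ := hf
  exact ⟨p, P, fun a => by rw [h]; exact hp a⟩

theorem congr {f g : α → β} (hf : PolyTime f) (h : ∀ a, g a = f a) : PolyTime g := by
  rwa [funext h]

theorem comp {g : β → γ} {f : α → β} (hg : PolyTime g) (hf : PolyTime f) :
    PolyTime (fun a => g (f a)) := by
  have hs := hf.size_bdd
  obtain ⟨p, T, hT, hp⟩ := hf.exists_runs
  obtain ⟨q, U, hU, hq⟩ := hg.exists_runs
  exact polyTime_of_runs (hT.add (hU.comp hs)) fun a => (hp a).seq (hq (f a))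

theorem id : PolyTime (fun a : α => a) := of_enc_eq fun _ => rfl

theorem const (b : β) : PolyTime (fun _ : α => b) := by
  refine polyTime_of_runs (p := .seq (.clear 0) (.pushAll 0 (enc b)))
    (T := fun a => (2 * codeSize a + 1) + (codeSize b + 2)) ?_ fun a => ?_
  · exact ((((PolyBdd.const 2).mul .size).add (.const 1)).add (.const _))
  · have h1 : Runs (.clear 0) (st [enc a]) (st [[]]) (2 * codeSize a + 1) := by
      simpa [setAt, codeSize] using Runs.clearSt 0 [enc a]
    have h2 : Runs (.pushAll 0 (enc b)) (st [[]]) (st [enc b]) (codeSize b + 2) := by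
      have := Runs.pushAll 0 (enc b) (st [[]])
      rw [update_st] at this
      simpa [setAt, st, codeSize] using this
    exact h1.seq h2

/-- The stacks pass through `[a]`, `[a, a]`, `[a, f a]`, `[f a, [], a]`, `[f a, [], g a]`; the empty
stack is scratch space for `join`, and the code of a pair is a plain concatenation. -/
theorem pair {f : α → β} {g : α → γ} (hf : PolyTime f) (hg : PolyTime g) :
    PolyTime (fun a => (f a, g a)) := by
  have hsf := hf.size_bdd
  have hsg := hg.size_bdd
  obtain ⟨p, T, hT, hp⟩ := hf.exists_runs
  obtain ⟨q, U, hU, hq⟩ := hg.exists_runs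
  refine polyTime_of_runs (p := .seq .dup (.seq (p.map (fun v => v + 1)) (.seq .swap
      (.seq (q.map (fun v => v + 2)) .join)))) (T := fun a => (13 * codeSize a + 3) + (T a + (
    (8 * codeSize a + 8 * codeSize (f a) + 4) + (U a +
      (16 * codeSize (f a) + 8 * codeSize (g a) + 4))))) ?_ fun a => by
    have h3 := (Runs.swap (enc a) (enc (f a))).seq
      (((hq a).shift [enc (f a), []]).seq (Runs.join (enc (f a)) (enc (g a))))
    have h2 := ((hp a).shift [enc a]).seq h3
    exact (Runs.dup (enc a)).seq h2
  have hs : PolyBdd (fun a : α => codeSize a) := .size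
  exact (((PolyBdd.const 13).mul hs).add (.const 3)).add (hT.add
    (((((PolyBdd.const 8).mul hs).add ((PolyBdd.const 8).mul hsf)).add (.const 4)).add
    (hU.add ((((PolyBdd.const 16).mul hsf).add ((PolyBdd.const 8).mul hsg)).add (.const 4)))))

/-- Case distinction on a bit. -/
theorem boolCases {f g : γ → β} (hf : PolyTime f) (hg : PolyTime g) :
    PolyTime (fun a : Bool × γ => if a.1 then g a.2 else f a.2) := by
  obtain ⟨p, T, hT, hp⟩ := hf.exists_runs
  obtain ⟨q, U, hU, hq⟩ := hg.exists_runs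
  have hsz : PolyBdd (fun a : Bool × γ => codeSize a.2) := PolyBdd.size.of_le fun a => by
    simp [codeSize, BitCode.enc]
  refine polyTime_of_runs (p := .branch 0 .skip (.seq (.pop 0) p) (.seq (.pop 0) q))
    (T := fun a : Bool × γ => 1 + (T a.2 + U a.2) + 1) ?_ fun a => ?_
  · exact (((PolyBdd.const 1).add ((hT.comp hsz).add (hU.comp hsz))).add (.const 1))
  · obtain ⟨b, c⟩ := a
    have h0 : Runs (.pop 0) (st [enc (b, c)]) (st [enc c]) 1 := by
      simpa [setAt, BitCode.enc] using Runs.pop 0 [enc (b, c)]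
    refine Runs.branch_cons (b := b) (w := enc c) (by simp [st, BitCode.enc]) ?_
    cases b
    · exact (h0.seq (hp c)).mono (by simp)
    · exact (h0.seq (hq c)).mono (by simp)

/-- Case distinction on a list. -/
theorem listCases {δ : Type} [BitCode δ] {f : γ → β} {g : δ × (List δ × γ) → β}
    (hf : PolyTime f) (hg : PolyTime g) :
    PolyTime (fun a : List δ × γ => match a.1 with
      | [] => f a.2
      | d :: l => g (d, (l, a.2))) := by
  obtain ⟨p, T, ⟨P, hT⟩, hp⟩ := hf.exists_runs
  obtain ⟨q, U, ⟨Q, hU⟩, hq⟩ := hg.exists_runs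
  refine polyTime_of_runs (p := .branch 0 .skip (.seq (.pop 0) p) (.seq (.pop 0) q))
    (T := fun a : List δ × γ => 1 + (P.eval (codeSize a) + Q.eval (codeSize a)) + 1) ?_
    fun a => ?_
  · exact (((PolyBdd.const 1).add ((PolyBdd.eval _ .size).add (PolyBdd.eval _ .size))).add
      (.const 1))
  · obtain ⟨l, c⟩ := a
    cases l with
    | nil =>
      have h0 : Runs (.pop 0) (st [enc (([] : List δ), c)]) (st [enc c]) 1 := by
        simpa [setAt, BitCode.enc, encList] using Runs.pop 0 [enc (([] : List δ), c)]
      refine Runs.branch_cons (b := false) (w := enc c)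
        (by simp [st, BitCode.enc, encList]) ?_
      refine (h0.seq (hp c)).mono ?_
      have := (hT c).trans (P.eval_mono_nat (n := codeSize (([] : List δ), c))
        (by simp [codeSize, BitCode.enc]))
      omega
    | cons d l =>
      -- Reassociation is free: once the announcing bit is popped, what is left is already the code
      -- of the triple.
      have e : enc (d :: l, c) = true :: enc (d, (l, c)) := by
        simp [BitCode.enc, encList]
      have h0 : Runs (.pop 0) (st [enc (d :: l, c)]) (st [enc (d, (l, c))]) 1 := by
        rw [e]
        simpa [setAt] using Runs.pop 0 [true :: enc (d, (l, c))]
      refine Runs.branch_cons (b := true) (w := enc (d, (l, c)))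
        (by rw [e]; simp [st]) ?_
      refine (h0.seq (hq (d, (l, c)))).mono ?_
      have := (hU (d, (l, c))).trans (Q.eval_mono_nat (n := codeSize (d :: l, c))
        (by simp [codeSize, e]))
      omega

theorem cons : PolyTime (fun a : α × List α => a.1 :: a.2) := by
  refine polyTime_of_runs (p := .push 0 true) (.const 1) fun a => ?_
  have := Runs.push 0 true [enc a]
  simpa [setAt, BitCode.enc, encList] using this

/-- Iterating a polynomial-time function, with polynomially bounded values, as many times as the
length of the code of the input. -/
theorem iterate {f : α → α} (hf : PolyTime f) (Q : Polynomial ℕ)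
    (hQ : ∀ a k, k ≤ codeSize a → codeSize (f^[k] a) ≤ Q.eval (codeSize a)) :
    PolyTime (fun a => f^[codeSize a] a) := by
  obtain ⟨p, T, ⟨P, hT⟩, hp⟩ := hf.exists_runs
  -- The copy of the input on stack `0` is the clock: each round consumes one of its bits, while `f`
  -- acts on stack `1`.
  set body : Prog := .seq (.pop 0) (p.map (fun v => v + 1)) with hbody
  have loop : ∀ (w : List Bool) (a : α) (B : ℕ),
      (∀ k ≤ w.length, codeSize (f^[k] a) ≤ B) →
      Runs (.loop 0 body) (st [w, enc a]) (st [[], enc (f^[w.length] a)])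
        (w.length * (P.eval B + 2) + 1) := by
    intro w
    induction w with
    | nil => intro a B _; exact (Runs.loop_stop (by simp [st])).mono (by omega)
    | cons b w ih =>
      intro a B hB
      have h1 : Runs (.pop 0) (st [b :: w, enc a]) (st [w, enc a]) 1 := by
        simpa [setAt] using Runs.pop 0 [b :: w, enc a]
      have h2 := (hp a).shift [w]
      have h3 := ih (f a) B (fun k hk => by
        have := hB (k + 1) (by simpa using hk)
        simpa using this)
      have hTa : T a ≤ P.eval B :=
        (hT a).trans (P.eval_mono_nat (by simpa using hB 0 (by simp)))
      refine (Runs.loop_step (by simp [st]) (h1.seq h2) h3).mono ?_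
      simp only [List.length_cons, add_mul]
      omega
  refine polyTime_of_runs (T := fun a => (13 * codeSize a + 3) +
    ((codeSize a * (P.eval (Q.eval (codeSize a)) + 2) + 1) + (8 * Q.eval (codeSize a) + 2)))
    ?_ fun a =>
    (Runs.dup (enc a)).seq ((loop (enc a) a (Q.eval (codeSize a)) (hQ a)).seq
      ((Runs.down _).mono ?_))
  · have hs : PolyBdd (fun a : α => codeSize a) := .size
    have hq : PolyBdd (fun a : α => Q.eval (codeSize a)) := .eval Q hs
    exact (((PolyBdd.const 13).mul hs).add (.const 3)).add
      (((hs.mul ((PolyBdd.eval P hq).add (.const 2))).add (.const 1)).add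
        (((PolyBdd.const 8).mul hq).add (.const 2)))
  · have := hQ a (codeSize a) le_rfl
    rw [codeSize] at this
    change codeSize _ ≤ _ at this
    have e : (enc (f^[(enc a).length] a)).length ≤ Q.eval (codeSize a) := this
    omega

/-- The length of the code of the input, in unary. -/
theorem unarySize : PolyTime (fun a : α => List.replicate (codeSize a) ()) := by
  set body : Prog := .seq (.pop 0) (.push 1 true) with hbody
  have loop : ∀ (w : List Bool) (n : ℕ),
      Runs (.loop 0 body) (st [w, enc (List.replicate n ())])
        (st [[], enc (List.replicate (w.length + n) ())]) (w.length * 3 + 1) := by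
    intro w
    induction w with
    | nil => intro n; simpa using Runs.loop_stop (by simp [st])
    | cons b w ih =>
      intro n
      have h1 : Runs (.pop 0) (st [b :: w, enc (List.replicate n ())])
          (st [w, enc (List.replicate n ())]) 1 := by
        simpa [setAt] using Runs.pop 0 [b :: w, enc (List.replicate n ())]
      have h2 : Runs (.push 1 true) (st [w, enc (List.replicate n ())])
          (st [w, enc (List.replicate (n + 1) ())]) 1 := by
        have := Runs.push 1 true [w, enc (List.replicate n ())]
        simpa [setAt, List.replicate_succ, BitCode.enc, encList] using this
      refine cast ?_ ((Runs.loop_step (by simp [st]) (h1.seq h2) (ih (n + 1))).mono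
        (T' := (b :: w).length * 3 + 1) (by simp; omega))
      rw [List.length_cons, add_assoc, add_comm 1 n]
  have h0 : ∀ w : List Bool, Runs (.push 1 false) (st [w])
      (st [w, enc (List.replicate 0 ())]) 1 := by
    intro w
    have := Runs.push 1 false [w]
    simpa [setAt, BitCode.enc, encList] using this
  have hlen : ∀ n, (enc (List.replicate n ())).length = n + 1 := by
    intro n
    induction n with
    | zero => rfl
    | succ n ih =>
      rw [List.replicate_succ]
      simp only [BitCode.enc, encList, List.nil_append, List.length_cons] at ih ⊢
      omega
  refine polyTime_of_runs (T := fun a : α => 1 + ((codeSize a * 3 + 1) +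
    (8 * (codeSize a + 1) + 2))) ?_ fun a =>
    (h0 (enc a)).seq ((loop (enc a) 0).seq ((Runs.down _).mono ?_))
  · have hs : PolyBdd (fun a : α => codeSize a) := .size
    exact (PolyBdd.const 1).add (((hs.mul (.const 3)).add (.const 1)).add
      (((PolyBdd.const 8).mul (hs.add (.const 1))).add (.const 2)))
  · rw [hlen]; simp [codeSize]

end PolyTime
end

/-! ## Splitting codes -/

/-- The codes of the elements of `α` can be split off in time polynomial in their length. -/
class Splittable (α : Type) [BitCode α] : Prop where
  exists_split : ∃ (p : Prog) (P : Polynomial ℕ), ∀ (a : α) (t acc : List Bool),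
    Runs p (st [enc a ++ t, acc]) (st [t, (enc a).reverse ++ acc]) (P.eval (codeSize a))

section
variable {α β γ δ σ : Type} [BitCode α] [BitCode β] [BitCode γ] [BitCode δ] [BitCode σ]

theorem codeSize_prod (a : α × β) : codeSize a = codeSize a.1 + codeSize a.2 := by
  simp [codeSize, enc]

@[simp] theorem codeSize_pair (a : α) (b : β) : codeSize (a, b) = codeSize a + codeSize b :=
  codeSize_prod (a, b)

@[simp] theorem codeSize_nil : codeSize ([] : List α) = 1 := rfl

@[simp] theorem codeSize_cons (a : α) (l : List α) :
    codeSize (a :: l) = codeSize a + codeSize l + 1 := by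
  simp [codeSize, enc, encList]

@[simp] theorem codeSize_unit (a : Unit) : codeSize a = 0 := rfl

@[simp] theorem codeSize_bool (a : Bool) : codeSize a = 1 := rfl

theorem length_lt_codeSize (l : List α) : l.length < codeSize l := by
  induction l with
  | nil => simp
  | cons a l ih => simp; omega

theorem codeSize_mem {a : α} {l : List α} (h : a ∈ l) : codeSize a ≤ codeSize l := by
  induction l with
  | nil => simp at h
  | cons b l ih =>
    rcases List.mem_cons.mp h with rfl | h
    · simp; omega
    · have := ih h; simp; omega

theorem codeSize_listUnit (l : List Unit) : codeSize l = l.length + 1 := by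
  induction l with
  | nil => rfl
  | cons a l ih => simp [ih]

theorem codeSize_listBool (l : List Bool) : codeSize l = 2 * l.length + 1 := by
  induction l with
  | nil => rfl
  | cons a l ih => simp [ih]; omega

theorem Splittable.of_enc_eq (r : α → β) (hr : ∀ a, enc a = enc (r a)) [h : Splittable β] :
    Splittable α := by
  obtain ⟨p, P, hp⟩ := h.exists_split
  refine ⟨p, P, fun a t acc => ?_⟩
  have := hp (r a) t acc
  unfold codeSize at *
  rwa [hr]

instance : Splittable Unit :=
  ⟨.skip, Polynomial.C 2, fun a t acc => by simpa [enc] using Runs.skip _⟩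

/-- Move one bit from stack `0` to stack `1`. -/
def Prog.moveBit : Prog :=
  .branch 0 .skip (.seq (.pop 0) (.push 1 false)) (.seq (.pop 0) (.push 1 true))

theorem Runs.moveBit (b : Bool) (t acc : List Bool) (l : List (List Bool)) :
    Runs Prog.moveBit (st ((b :: t) :: acc :: l)) (st (t :: (b :: acc) :: l)) 3 := by
  have key : ∀ c, Runs (.seq (.pop 0) (.push 1 c)) (st ((b :: t) :: acc :: l))
      (st (t :: (c :: acc) :: l)) 2 := by
    intro c
    have h1 := Runs.pop 0 ((b :: t) :: acc :: l)
    have h2 := Runs.push 1 c (t :: acc :: l)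
    simp only [setAt, List.getD_cons_zero, List.getD_cons_succ, List.tail_cons] at h1 h2
    exact h1.seq h2
  refine Runs.branch_cons (b := b) (w := t) (by simp [st]) ?_
  cases b <;> exact key _

instance : Splittable Bool :=
  ⟨.moveBit, Polynomial.C 3, fun a t acc => by simpa [enc] using Runs.moveBit a t acc []⟩

instance [hα : Splittable α] [hβ : Splittable β] : Splittable (α × β) := by
  obtain ⟨p, P, hp⟩ := hα.exists_split
  obtain ⟨q, Q, hq⟩ := hβ.exists_split
  refine ⟨.seq p q, P + Q, fun a t acc => ?_⟩
  have h1 := hp a.1 (enc a.2 ++ t) acc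
  have h2 := hq a.2 t ((enc a.1).reverse ++ acc)
  have e : enc a = enc a.1 ++ enc a.2 := rfl
  rw [e, List.append_assoc, List.reverse_append, List.append_assoc]
  refine (h1.seq h2).mono ?_
  rw [Polynomial.eval_add, codeSize_prod]
  exact Nat.add_le_add (P.eval_mono_nat (by omega)) (Q.eval_mono_nat (by omega))

/-- Renaming of stacks that leaves stack `2` unused. -/
def skipTwo (v : ℕ) : ℕ := if v < 2 then v else v + 1

theorem skipTwo_injective : Function.Injective skipTwo := by
  intro a b h
  unfold skipTwo at h
  split_ifs at h <;> omega

/-- Splitting a list keeps a control bit on stack `2`, which the splitting program for the elements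
must not disturb. -/
theorem Runs.mapSkipTwo {p : Prog} {x y x' y' : List Bool} {T : ℕ}
    (h : Runs p (st [x, y]) (st [x', y']) T) (z : List Bool) :
    Runs (p.map skipTwo) (st [x, y, z]) (st [x', y', z]) T := by
  have key : ∀ u v, Function.extend skipTwo (st [u, v]) (st [[], [], z]) = st [u, v, z] := by
    intro u v
    funext w
    match w with
    | 0 => exact skipTwo_injective.extend_apply _ _ 0
    | 1 => exact skipTwo_injective.extend_apply _ _ 1
    | 2 =>
      rw [Function.extend_apply']
      · rfl
      · rintro ⟨a, ha⟩
        unfold skipTwo at ha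
        split_ifs at ha <;> omega
    | w + 3 => exact skipTwo_injective.extend_apply _ _ (w + 2)
  have := h.map skipTwo_injective (st [[], [], z])
  rwa [key, key] at this

instance [hα : Splittable α] : Splittable (List α) := by
  obtain ⟨p, P, hp⟩ := hα.exists_split
  -- Stack `2` is nonempty as long as the end of the list has not been read; each announced element
  -- restores the bit that the round removed.
  set body : Prog := .seq (.pop 2) (.branch 0 .skip .moveBit
    (.seq .moveBit (.seq (p.map skipTwo) (.push 2 true)))) with hbody
  have pop : ∀ x y : List Bool, Runs (.pop 2) (st [x, y, [true]]) (st [x, y]) 1 := by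
    intro x y
    simpa [setAt, st_two] using Runs.pop 2 [x, y, [true]]
  have push : ∀ x y : List Bool, Runs (.push 2 true) (st [x, y]) (st [x, y, [true]]) 1 := by
    intro x y
    simpa [setAt] using Runs.push 2 true [x, y]
  have loop : ∀ (B : ℕ) (l : List α) (t acc : List Bool), (∀ a ∈ l, codeSize a ≤ B) →
      Runs (.loop 2 body) (st [enc l ++ t, acc, [true]]) (st [t, (enc l).reverse ++ acc])
        ((l.length + 1) * (P.eval B + 8)) := by
    intro B l
    induction l with
    | nil =>
      intro t acc _
      have e : enc ([] : List α) = [false] := rfl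
      have h2 : Runs (.branch 0 .skip .moveBit
          (.seq .moveBit (.seq (p.map skipTwo) (.push 2 true)))) (st [false :: t, acc])
          (st [t, false :: acc]) 4 :=
        Runs.branch_cons (b := false) (w := t) (by simp [st]) (Runs.moveBit false t acc [])
      rw [e]
      refine (Runs.loop_step (by simp [st]) ((pop _ _).seq h2)
        (Runs.loop_stop (by simp [st]))).mono ?_
      simp
    | cons a l ih =>
      intro t acc hB
      have e : enc (a :: l) = true :: (enc a ++ enc l) := rfl
      have h1 : Runs (p.map skipTwo) (st [enc a ++ (enc l ++ t), true :: acc])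
          (st [enc l ++ t, (enc a).reverse ++ true :: acc]) (P.eval (codeSize a)) := by
        simpa only [st_two] using (hp a (enc l ++ t) (true :: acc)).mapSkipTwo []
      have h2 : Runs (.branch 0 .skip .moveBit
          (.seq .moveBit (.seq (p.map skipTwo) (.push 2 true))))
          (st [true :: (enc a ++ (enc l ++ t)), acc])
          (st [enc l ++ t, (enc a).reverse ++ true :: acc, [true]])
          (3 + (P.eval (codeSize a) + 1) + 1) :=
        Runs.branch_cons (b := true) (w := enc a ++ (enc l ++ t)) (by simp [st])
          ((Runs.moveBit true _ acc []).seq (h1.seq (push _ _)))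
      have h3 := ih t ((enc a).reverse ++ true :: acc)
        (fun b hb => hB b (List.mem_cons_of_mem _ hb))
      have e1 : enc (a :: l) ++ t = true :: (enc a ++ (enc l ++ t)) := by simp [e]
      have e2 : (enc (a :: l)).reverse ++ acc
          = (enc l).reverse ++ ((enc a).reverse ++ true :: acc) := by simp [e]
      rw [e1, e2]
      refine (Runs.loop_step (by simp [st]) ((pop _ _).seq h2) h3).mono ?_
      have := P.eval_mono_nat (hB a (by simp))
      simp only [List.length_cons, add_mul] at *
      omega
  refine ⟨.seq (.push 2 true) (.loop 2 body), 1 + (Polynomial.X * (P + 8)), fun l t acc => ?_⟩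
  refine ((push _ _).seq (loop (codeSize l) l t acc fun a ha => codeSize_mem ha)).mono ?_
  simp only [Polynomial.eval_add, Polynomial.eval_mul, Polynomial.eval_one, Polynomial.eval_X,
    Polynomial.eval_ofNat]
  exact Nat.add_le_add_left (Nat.mul_le_mul_right _ (length_lt_codeSize l)) 1

instance : Splittable ℕ := .of_enc_eq Nat.bits fun _ => rfl
instance : Splittable ℤ :=
  .of_enc_eq (fun z : ℤ => (decide (z < 0), z.natAbs)) fun _ => rfl
instance : Splittable ℚ := .of_enc_eq (fun y : ℚ => (y.num, y.den)) fun _ => rfl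

/-! ### Projections, case distinctions and folds. -/

namespace PolyTime

/-- No separator stands between the components of a pair, so the boundary is found by parsing the
first code. -/
theorem fst [h : Splittable α] : PolyTime (fun a : α × β => a.1) := by
  obtain ⟨p, P, hp⟩ := h.exists_split
  refine polyTime_of_runs (p := .seq p (.seq (.clear 0) (.move 1 0)))
    (T := fun a : α × β => P.eval (codeSize a.1) + ((2 * codeSize a.2 + 1) +
      (4 * codeSize a.1 + 1))) ?_ fun a => ?_
  · have h1 : PolyBdd (fun a : α × β => codeSize a.1) :=
      PolyBdd.size.of_le fun a => by rw [codeSize_prod]; omega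
    have h2 : PolyBdd (fun a : α × β => codeSize a.2) :=
      PolyBdd.size.of_le fun a => by rw [codeSize_prod]; omega
    exact (PolyBdd.eval P h1).add ((((PolyBdd.const 2).mul h2).add (.const 1)).add
      (((PolyBdd.const 4).mul h1).add (.const 1)))
  · have h1 := hp a.1 (enc a.2) []
    rw [st_one, List.append_nil] at h1
    have h2 := Runs.clearSt 0 [enc a.2, (enc a.1).reverse]
    have h3 := Runs.moveSt (u := 1) (v := 0) (by simp) [[], (enc a.1).reverse]
    simp only [setAt, List.getD_cons_zero, List.getD_cons_succ, List.reverse_reverse,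
      List.append_nil, List.length_reverse, st_one] at h2 h3
    exact h1.seq (h2.seq h3)

theorem snd [h : Splittable α] : PolyTime (fun a : α × β => a.2) := by
  obtain ⟨p, P, hp⟩ := h.exists_split
  refine polyTime_of_runs (p := .seq p (.clear 1))
    (T := fun a : α × β => P.eval (codeSize a.1) + (2 * codeSize a.1 + 1)) ?_ fun a => ?_
  · have h1 : PolyBdd (fun a : α × β => codeSize a.1) :=
      PolyBdd.size.of_le fun a => by rw [codeSize_prod]; omega
    exact (PolyBdd.eval P h1).add (((PolyBdd.const 2).mul h1).add (.const 1))
  · have h1 := hp a.1 (enc a.2) []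
    rw [st_one, List.append_nil] at h1
    have h2 := Runs.clearSt 1 [enc a.2, (enc a.1).reverse]
    simp only [setAt, List.getD_cons_zero, List.getD_cons_succ, List.length_reverse,
      st_one] at h2
    exact h1.seq h2

/-! ### Derived closure properties -/

theorem ite {c : α → Bool} {f g : α → β} (hc : PolyTime c) (hf : PolyTime f) (hg : PolyTime g) :
    PolyTime (fun a => if c a then f a else g a) :=
  (boolCases hg hf).comp (hc.pair id)

theorem not {c : α → Bool} (hc : PolyTime c) : PolyTime (fun a => !c a) :=
  (ite hc (const false) (const true)).congr fun a => by cases c a <;> rfl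

theorem and {c d : α → Bool} (hc : PolyTime c) (hd : PolyTime d) :
    PolyTime (fun a => c a && d a) :=
  (ite hc hd (const false)).congr fun a => by cases c a <;> rfl

theorem isEmpty : PolyTime (fun l : List α => l.isEmpty) :=
  ((listCases (γ := Unit) (δ := α) (const true) (const false)).comp
    (id.pair (const ()))).congr fun l => by cases l <;> rfl

theorem tail [Splittable α] : PolyTime (fun l : List α => l.tail) :=
  ((listCases (γ := Unit) (δ := α) (g := fun x => x.2.1) (const []) (fst.comp snd)).comp
    (id.pair (const ()))).congr fun l => by cases l <;> rfl

theorem headD [Splittable α] (d : α) : PolyTime (fun l : List α => l.headD d) :=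
  ((listCases (γ := Unit) (δ := α) (g := fun x => x.1) (const d) fst).comp
    (id.pair (const ()))).congr fun l => by cases l <;> rfl

/-- One round of `F` consumes one list element, and `F` fixes a state whose list is exhausted. Hence
`iterate` computes the fold, the code of the input being longer than the list. The hypothesis on
prefixes keeps the intermediate states polynomially small. -/
theorem foldl [Splittable δ] {step : σ → δ → σ}
    (hstep : PolyTime (fun a : σ × δ => step a.1 a.2)) (Q : Polynomial ℕ)
    (hQ : ∀ (s : σ) (l : List δ) (k : ℕ),
      codeSize ((l.take k).foldl step s) ≤ Q.eval (codeSize (l, s))) :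
    PolyTime (fun a : List δ × σ => a.1.foldl step a.2) := by
  let F : List δ × σ → List δ × σ := fun a => match a.1 with
    | [] => ([], a.2)
    | d :: l => (l, step a.2 d)
  have hF : PolyTime F := listCases (f := fun s : σ => (([] : List δ), s))
    (g := fun x : δ × (List δ × σ) => (x.2.1, step x.2.2 x.1)) ((const []).pair id)
    ((fst.comp snd).pair (hstep.comp ((snd.comp snd).pair fst)))
  have hit : ∀ (k : ℕ) (l : List δ) (s : σ),
      F^[k] (l, s) = (l.drop k, (l.take k).foldl step s) := by
    intro k
    induction k with
    | zero => intro l s; simp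
    | succ k ih =>
      intro l s
      rw [Function.iterate_succ_apply]
      cases l with
      | nil => simpa using ih [] s
      | cons d l => simpa using ih l (step s d)
  have hdrop : ∀ (l : List δ) (k : ℕ), codeSize (l.drop k) ≤ codeSize l := by
    intro l
    induction l with
    | nil => intro k; simp
    | cons a l ih =>
      intro k
      cases k with
      | zero => simp
      | succ k => have := ih k; simp; omega
  have h := iterate hF (Polynomial.X + Q) (fun a k _ => by
    obtain ⟨l, s⟩ := a
    have h1 := hQ s l k
    have h2 := hdrop l k
    rw [hit, codeSize_pair, Polynomial.eval_add, Polynomial.eval_X]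
    rw [codeSize_pair] at h1 ⊢
    omega)
  refine (snd.comp h).congr fun a => ?_
  obtain ⟨l, s⟩ := a
  have : l.length ≤ codeSize (l, s) := by
    have := length_lt_codeSize l
    rw [codeSize_pair]; omega
  change l.foldl step s = (F^[codeSize (l, s)] (l, s)).2
  rw [hit, List.take_of_length_le this]

end PolyTime
end

/-! ## Polynomial-time list functions -/

namespace PolyTime

variable {α β γ δ σ : Type} [BitCode α] [BitCode β] [BitCode γ] [BitCode δ] [BitCode σ]

/-- A fold whose steps enlarge the state by a polynomial in the current list element. -/
theorem foldl_of_le [Splittable δ] {step : σ → δ → σ}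
    (hstep : PolyTime (fun a : σ × δ => step a.1 a.2)) (P : Polynomial ℕ)
    (hP : ∀ s d, codeSize (step s d) ≤ codeSize s + P.eval (codeSize d)) :
    PolyTime (fun a : List δ × σ => a.1.foldl step a.2) := by
  refine foldl hstep (Polynomial.X + Polynomial.X * P) fun s l k => ?_
  have key : ∀ (B : ℕ) (l : List δ) (s : σ), (∀ d ∈ l, codeSize d ≤ B) →
      codeSize (l.foldl step s) ≤ codeSize s + l.length * P.eval B := by
    intro B l
    induction l with
    | nil => intro s _; simp
    | cons d l ih =>
      intro s hB
      have h1 := ih (step s d) fun e he => hB e (List.mem_cons_of_mem _ he)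
      have h2 := hP s d
      have h3 := P.eval_mono_nat (hB d (by simp))
      rw [List.foldl_cons, List.length_cons, add_mul]
      omega
  have h := key (codeSize (l, s)) (l.take k) s fun d hd => by
    have := codeSize_mem (List.mem_of_mem_take hd)
    rw [codeSize_pair]; omega
  have h1 : (l.take k).length ≤ codeSize (l, s) := by
    have := length_lt_codeSize l
    rw [codeSize_pair, List.length_take]; omega
  have h2 := Nat.mul_le_mul_right (P.eval (codeSize (l, s))) h1
  simp only [Polynomial.eval_add, Polynomial.eval_mul, Polynomial.eval_X]
  have h3 : codeSize s ≤ codeSize (l, s) := by rw [codeSize_pair]; omega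
  omega

theorem revAppend [Splittable α] :
    PolyTime (fun a : List α × List α => a.1.reverse ++ a.2) := by
  have h : PolyTime (fun a : List α × α => a.2 :: a.1) := cons.comp (snd.pair fst)
  refine (foldl_of_le (step := fun s d => d :: s) h (Polynomial.X + 1)
    fun s d => by simp; omega).congr fun a => ?_
  obtain ⟨l, s⟩ := a
  induction l generalizing s with
  | nil => rfl
  | cons d l ih => simp

theorem reverse [Splittable α] : PolyTime (fun l : List α => l.reverse) :=
  (revAppend.comp (id.pair (const []))).congr fun l => by simp

theorem append [Splittable α] : PolyTime (fun a : List α × List α => a.1 ++ a.2) :=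
  (revAppend.comp ((reverse.comp fst).pair snd)).congr fun a => by simp

theorem map [Splittable α] {f : α → β} [Splittable β] (hf : PolyTime f) :
    PolyTime (fun l : List α => l.map f) := by
  obtain ⟨P, hP⟩ := hf.size_bdd
  have h : PolyTime (fun a : List β × α => f a.2 :: a.1) := cons.comp ((hf.comp snd).pair fst)
  have h2 := foldl_of_le (step := fun s d => f d :: s) h (P + 1) fun s d => by
    have : codeSize (f d) ≤ P.eval (codeSize d) := hP d
    simp; omega
  refine (reverse.comp (h2.comp (id.pair (const [])))).congr fun l => ?_
  have key : ∀ (l : List α) (s : List β),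
      l.foldl (fun s d => f d :: s) s = (l.map f).reverse ++ s := by
    intro l
    induction l with
    | nil => intro s; rfl
    | cons d l ih => intro s; simp [ih]
  simp [key]

/-- Numbers that control a computation are written in unary, as lists of `Unit`. -/
theorem length [Splittable α] : PolyTime (fun l : List α => List.replicate l.length ()) :=
  (map (const ())).congr fun l => by simp

theorem drop [Splittable α] : PolyTime (fun a : List Unit × List α => a.2.drop a.1.length) := by
  have h : PolyTime (fun a : List α × Unit => a.1.tail) := tail.comp fst
  refine (foldl_of_le (step := fun s _ => s.tail) h 0 fun s d => ?_).congr fun a => ?_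
  · cases s <;> simp; omega
  · obtain ⟨l, s⟩ := a
    induction l generalizing s with
    | nil => rfl
    | cons d l ih => simpa using ih s.tail

theorem take [Splittable α] : PolyTime (fun a : List Unit × List α => a.2.take a.1.length) := by
  let F : List α × List α → List α × List α := fun a => match a.1 with
    | [] => ([], a.2)
    | d :: l => (l, d :: a.2)
  have hF : PolyTime F := listCases (f := fun s : List α => (([] : List α), s))
    (g := fun x : α × (List α × List α) => (x.2.1, x.1 :: x.2.2)) ((const []).pair id)
    ((fst.comp snd).pair (cons.comp (fst.pair (snd.comp snd))))
  have h : PolyTime (fun a : (List α × List α) × Unit => F a.1) := hF.comp fst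
  have h2 := foldl_of_le (step := fun s _ => F s) h 0 fun s d => by
    obtain ⟨l, s⟩ := s
    cases l <;> simp [F]
    omega
  have h3 : PolyTime (fun a : List Unit × List α => (a.1, (a.2, ([] : List α)))) :=
    fst.pair (snd.pair (const []))
  refine (reverse.comp (snd.comp (h2.comp h3))).congr fun a => ?_
  obtain ⟨u, l⟩ := a
  have key : ∀ (u : List Unit) (l s : List α),
      u.foldl (fun s _ => F s) (l, s) = (l.drop u.length, (l.take u.length).reverse ++ s) := by
    intro u
    induction u with
    | nil => intro l s; rfl
    | cons d u ih => intro l s; cases l <;> simp [ih, F]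
  simp [key]

theorem unit_ext {u v : List Unit} (h : u.length = v.length) : u = v :=
  List.ext_getElem h fun _ _ _ => rfl

/-- Each step adds the length of the second factor, which is carried in the state and not bounded by
the current element; so `foldl_of_le` does not apply and the size is bounded through the closed form
`key`. -/
theorem unaryMul :
    PolyTime (fun a : List Unit × List Unit => List.replicate (a.1.length * a.2.length) ()) := by
  have h : PolyTime (fun a : (List Unit × List Unit) × Unit => (a.1.1, a.1.1 ++ a.1.2)) :=
    (fst.comp fst).pair (append.comp fst)
  have key : ∀ (u v s : List Unit),
      u.foldl (fun (s : List Unit × List Unit) _ => (s.1, s.1 ++ s.2)) (v, s)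
        = (v, List.replicate (u.length * v.length + s.length) ()) := by
    intro u
    induction u with
    | nil => intro v s; exact Prod.ext rfl (unit_ext (by simp))
    | cons d u ih =>
      intro v s
      rw [List.foldl_cons, ih]
      exact Prod.ext rfl (unit_ext (by simp [add_mul]; omega))
  have h2 := foldl
    (step := fun (s : List Unit × List Unit) (_ : Unit) => (s.1, s.1 ++ s.2)) h
    (Polynomial.X + Polynomial.X * Polynomial.X) fun s l k => by
    obtain ⟨v, s⟩ := s
    rw [key]
    simp only [codeSize_pair, codeSize_listUnit, List.length_replicate, Polynomial.eval_add,
      Polynomial.eval_mul, Polynomial.eval_X, List.length_take]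
    have : min k l.length * v.length ≤ (l.length + 1 + (v.length + 1 + (s.length + 1))) *
        (l.length + 1 + (v.length + 1 + (s.length + 1))) :=
      Nat.mul_le_mul (by omega) (by omega)
    omega
  have h3 : PolyTime (fun a : List Unit × List Unit => (a.1, (a.2, ([] : List Unit)))) :=
    fst.pair (snd.pair (const []))
  exact (snd.comp (h2.comp h3)).congr fun a => by simp [key]

/-- Evaluation of a polynomial in unary. -/
theorem unaryEval (p : Polynomial ℕ) :
    PolyTime (fun u : List Unit => List.replicate (p.eval u.length) ()) := by
  induction p using Polynomial.induction_on with
  | C a => exact (const (List.replicate a ())).congr fun u => by simp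
  | add p q hp hq =>
    exact (append.comp (hp.pair hq)).congr fun u => by
      rw [Polynomial.eval_add, List.replicate_add]
  | monomial n a h =>
    exact (unaryMul.comp (h.pair id)).congr fun u => by
      rw [pow_succ, ← mul_assoc, Polynomial.eval_mul, Polynomial.eval_X, List.length_replicate]

/-- Removal of the leading ones. -/
theorem dropOnes : PolyTime (fun l : List Bool => l.dropWhile (fun b => b)) := by
  let F : List Bool → List Bool := fun l => match l with
    | [] => []
    | b :: l => if b then l else false :: l
  have hF : PolyTime F := by
    have h1 : PolyTime (fun x : Bool × List Bool => if x.1 then x.2 else false :: x.2) :=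
      boolCases (f := fun l => false :: l) (g := fun l => l) (cons.comp ((const false).pair id)) id
    have h2 : PolyTime (fun x : Bool × (List Bool × Unit) =>
        if x.1 then x.2.1 else false :: x.2.1) :=
      h1.comp (fst.pair (fst.comp snd))
    exact ((listCases (γ := Unit) (const []) h2).comp (id.pair (const ()))).congr fun l => by
      cases l <;> rfl
  have hsize : ∀ (k : ℕ) (l : List Bool), codeSize (F^[k] l) ≤ codeSize l := by
    intro k
    induction k with
    | zero => intro l; rfl
    | succ k ih =>
      intro l
      rw [Function.iterate_succ_apply]
      refine (ih _).trans ?_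
      rcases l with _ | ⟨b, l⟩
      · rfl
      · cases b <;> simp [F]
        omega
  -- Strings that are empty or begin with `0` are fixed points of `F`, so surplus rounds are
  -- harmless.
  have key : ∀ (k : ℕ) (l : List Bool), l.length ≤ k → F^[k] l = l.dropWhile (fun b => b) := by
    intro k
    induction k with
    | zero =>
      intro l hl
      have : l = [] := List.length_eq_zero_iff.mp (by omega)
      subst this; rfl
    | succ k ih =>
      intro l hl
      rw [Function.iterate_succ_apply]
      rcases l with _ | ⟨b, l⟩
      · exact ih [] (by simp)
      · cases b
        · have : ∀ m, F^[m] (false :: l) = false :: l := fun m =>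
            Function.iterate_fixed (by simp [F]) m
          simp [F, this]
        · simpa [F] using ih l (by simpa using hl)
  exact (iterate hF Polynomial.X fun a k _ => by simpa using hsize k a).congr fun l =>
    (key _ l (by have := length_lt_codeSize l; omega)).symm

/-- Comparison of the lengths of two lists. -/
theorem lengthLe [Splittable α] [Splittable β] :
    PolyTime (fun a : List α × List β => decide (a.1.length ≤ a.2.length)) := by
  refine (isEmpty.comp (drop.comp ((length.comp snd).pair fst))).congr fun a => ?_
  rw [Bool.eq_iff_iff]
  simp [List.isEmpty_iff]

theorem lengthEq [Splittable α] [Splittable β] :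
    PolyTime (fun a : List α × List β => decide (a.1.length = a.2.length)) :=
  (lengthLe.and (lengthLe.comp (snd.pair fst))).congr fun a => by
    simp [le_antisymm_iff]

end PolyTime

/-! ## Probabilities -/

section
variable {α β γ : Type}

theorem prob_nonneg (A : PMF β) (S : Set β) : 0 ≤ prob A S := ENNReal.toReal_nonneg

theorem toOuterMeasure_le_one (A : PMF β) (S : Set β) : A.toOuterMeasure S ≤ 1 := by
  rw [PMF.toOuterMeasure_apply, ← A.tsum_coe]
  exact ENNReal.tsum_le_tsum fun a => Set.indicator_le_self _ _ a

theorem ofReal_prob (A : PMF β) (S : Set β) : ENNReal.ofReal (prob A S) = A.toOuterMeasure S :=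
  ENNReal.ofReal_toReal (ne_top_of_le_ne_top ENNReal.one_ne_top (toOuterMeasure_le_one A S))

theorem prob_le_one (A : PMF β) (S : Set β) : prob A S ≤ 1 :=
  ENNReal.toReal_le_of_le_ofReal zero_le_one (by simpa using toOuterMeasure_le_one A S)

theorem prob_mono (A : PMF β) {S T : Set β} (h : S ⊆ T) : prob A S ≤ prob A T :=
  ENNReal.toReal_mono (ne_top_of_le_ne_top ENNReal.one_ne_top (toOuterMeasure_le_one A T))
    (A.toOuterMeasure.mono h)

theorem prob_map (A : PMF α) (f : α → β) (S : Set β) : prob (A.map f) S = prob A (f ⁻¹' S) := by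
  rw [prob, prob, PMF.toOuterMeasure_map_apply]

theorem prob_pure_of_mem {b : β} {S : Set β} (h : b ∈ S) : prob (PMF.pure b) S = 1 := by
  simp [prob, PMF.toOuterMeasure_pure_apply, h]

theorem prob_bind_ge (A : PMF α) (f : α → PMF β) (G : Set α) (S : Set β) {x : ℝ}
    (h : ∀ a ∈ G, x ≤ prob (f a) S) : prob A G * x ≤ prob (A.bind f) S := by
  have hx : ENNReal.ofReal (prob A G * x) ≤ (A.bind f).toOuterMeasure S := by
    rw [ENNReal.ofReal_mul (prob_nonneg _ _), ofReal_prob, PMF.toOuterMeasure_bind_apply,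
      PMF.toOuterMeasure_apply, ← ENNReal.tsum_mul_right]
    refine ENNReal.tsum_le_tsum fun a => ?_
    by_cases ha : a ∈ G
    · rw [Set.indicator_of_mem ha, ← ofReal_prob]
      exact mul_le_mul_right (ENNReal.ofReal_le_ofReal (h a ha)) _
    · simp [ha]
  rw [← ofReal_prob] at hx
  exact (ENNReal.ofReal_le_ofReal_iff (prob_nonneg _ _)).mp hx

theorem prob_compl (A : PMF α) (S : Set α) : prob A Sᶜ = 1 - prob A S := by
  have h : A.toOuterMeasure S + A.toOuterMeasure Sᶜ = 1 := by
    rw [PMF.toOuterMeasure_apply, PMF.toOuterMeasure_apply, ← ENNReal.tsum_add, ← A.tsum_coe]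
    refine tsum_congr fun a => ?_
    by_cases ha : a ∈ S <;> simp [ha]
  rw [← ofReal_prob, ← ofReal_prob, ← ENNReal.ofReal_add (prob_nonneg _ _) (prob_nonneg _ _)] at h
  have := congrArg ENNReal.toReal h
  rw [ENNReal.toReal_ofReal (add_nonneg (prob_nonneg _ _) (prob_nonneg _ _))] at this
  simp at this
  linarith

/-- This provides a single output that is close to two targets at once when an algorithm estimates
both. -/
theorem inter_nonempty_of_prob (A : PMF α) {S T : Set α} (hS : 1 / 2 < prob A S)
    (hT : 1 / 2 < prob A T) : (S ∩ T).Nonempty := by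
  by_contra h
  have hsub : S ⊆ Tᶜ := by
    intro x hx hxT
    exact h ⟨x, hx, hxT⟩
  have := prob_mono A hsub
  rw [prob_compl] at this
  linarith

theorem map_uniformOfFintype_equiv [Fintype α] [Nonempty α] [Fintype β] [Nonempty β]
    (e : α ≃ β) : (PMF.uniformOfFintype α).map e = PMF.uniformOfFintype β := by
  ext b
  rw [PMF.map_apply, tsum_eq_single (e.symm b)]
  · simp [Fintype.card_congr e]
  · intro a ha
    rw [if_neg]
    rintro rfl
    simp at ha

theorem map_fst_uniformOfFintype [Fintype α] [Nonempty α] [Fintype β] [Nonempty β] :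
    (PMF.uniformOfFintype (α × β)).map Prod.fst = PMF.uniformOfFintype α := by
  ext a
  rw [PMF.map_apply, tsum_fintype, Fintype.sum_prod_type]
  rw [Finset.sum_eq_single a]
  · simp only [if_true, PMF.uniformOfFintype_apply, Finset.sum_const, Finset.card_univ,
      Fintype.card_prod, nsmul_eq_mul]
    have h1 : (Fintype.card α : ENNReal) ≠ 0 := by simp
    have h2 : (Fintype.card β : ENNReal) ≠ 0 := by simp
    rw [Nat.cast_mul, ENNReal.mul_inv (Or.inl h1) (Or.inl (ENNReal.natCast_ne_top _)),
      mul_comm, mul_assoc, ENNReal.inv_mul_cancel h2 (ENNReal.natCast_ne_top _), mul_one]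
  · intro b _ hb
    simp [Ne.symm hb]
  · simp

/-- The first `n` of `N` fair coin tosses. -/
theorem map_take_uniform {n N : ℕ} (h : n ≤ N) :
    (PMF.uniformOfFintype (Fin N → Bool)).map (fun r => (List.ofFn r).take n)
      = (PMF.uniformOfFintype (Fin n → Bool)).map (fun r => List.ofFn r) := by
  obtain ⟨m, rfl⟩ := Nat.exists_eq_add_of_le h
  rw [← map_uniformOfFintype_equiv (Fin.appendEquiv n m),
    ← map_fst_uniformOfFintype (α := Fin n → Bool) (β := Fin m → Bool), PMF.map_comp, PMF.map_comp]
  congr 1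
  funext r
  have : List.ofFn (Fin.append r.1 r.2) = List.ofFn r.1 ++ List.ofFn r.2 := by
    simp
  change (List.ofFn (Fin.append r.1 r.2)).take n = List.ofFn r.1
  rw [this, List.take_left' (by simp)]

end

/-! ## Efficient algorithms with pre- and postprocessing -/

section
variable {α β γ α' : Type} [BitCode α] [BitCode β] [BitCode γ] [BitCode α']

theorem IsQuantumAlgorithm.transform [Splittable α'] {A : α → PMF β} (hA : IsQuantumAlgorithm A)
    {φ : α' → α} (hφ : PolyTime φ) {ψ : α' × β → γ} (hψ : PolyTime ψ) :
    IsQuantumAlgorithm (fun a => (A (φ a)).map fun b => ψ (a, b)) := by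
  obtain ⟨C, g, hC, hg, hA⟩ := hA
  have hg' : PolyTime (fun a : α' × List Bool => ψ (a.1, g (φ a.1, a.2))) :=
    hψ.comp (PolyTime.fst.pair (hg.comp ((hφ.comp PolyTime.fst).pair PolyTime.snd)))
  refine ⟨fun a => C (φ a), _, hC.comp hφ, hg', fun a => ?_⟩
  change (A (φ a)).map _ = _
  rw [hA, PMF.map_comp]
  rfl

/-- The number of coins must be a polynomial in the code length of the new input, whereas the size
of `φ a` is only bounded by one. Coins are tossed for the bound and the surplus is discarded, which
leaves the rest uniform. -/
theorem IsClassicalAlgorithm.transform [Splittable α'] {A : α → PMF β}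
    (hA : IsClassicalAlgorithm A) {φ : α' → α} (hφ : PolyTime φ) {ψ : α' × β → γ}
    (hψ : PolyTime ψ) : IsClassicalAlgorithm (fun a => (A (φ a)).map fun b => ψ (a, b)) := by
  obtain ⟨q, g, hg, hA⟩ := hA
  obtain ⟨P, hP⟩ := hφ.size_bdd
  have hu : PolyTime (fun a : α' => List.replicate (q.eval (codeSize (φ a))) ()) :=
    ((PolyTime.unaryEval q).comp (PolyTime.unarySize.comp hφ)).congr fun a => by simp
  have hr : PolyTime (fun a : α' × List Bool => a.2.take (q.eval (codeSize (φ a.1)))) :=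
    (PolyTime.take.comp ((hu.comp PolyTime.fst).pair PolyTime.snd)).congr fun a => by simp
  have hg' : PolyTime (fun a : α' × List Bool =>
      ψ (a.1, g (φ a.1, a.2.take (q.eval (codeSize (φ a.1)))))) :=
    hψ.comp (PolyTime.fst.pair (hg.comp ((hφ.comp PolyTime.fst).pair hr)))
  refine ⟨q.comp P, _, hg', fun a => ?_⟩
  have hle : q.eval (codeSize (φ a)) ≤ (q.comp P).eval (codeSize a) := by
    rw [Polynomial.eval_comp]
    exact q.eval_mono_nat (hP a)
  have h := congrArg (PMF.map fun r => ψ (a, g (φ a, r))) (map_take_uniform hle)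
  rw [PMF.map_comp, PMF.map_comp] at h
  change (A (φ a)).map _ = _
  rw [hA, PMF.map_comp]
  exact h.symm

/-! ## Coin tosses from Hadamard gates -/

/-- Hadamard gates on all of `n` qubits. -/
def hadamards (n : ℕ) : Circuit := ⟨n, (List.finRange n).reverse.map Gate.H⟩

/-- The invariant is that the state is the uniform superposition of the strings that vanish outside
`S`. The next Hadamard gate meets a qubit that is still `0`, so only one of the two terms in each
new amplitude survives. -/
theorem foldl_hadamard {n : ℕ} (l : List (Fin n)) (S : Finset (Fin n)) (ψ : QState n)
    (hl : l.Nodup) (hS : ∀ i ∈ l, i ∉ S)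
    (hψ : ∀ x, ψ x = if ∀ i ∉ S, x i = false then ((Real.sqrt 2 : ℂ)⁻¹) ^ S.card else 0) :
    ∀ x, (l.map Gate.H).foldl (fun ψ g => g.act ψ) ψ x
      = if ∀ i ∉ S ∪ l.toFinset, x i = false then
          ((Real.sqrt 2 : ℂ)⁻¹) ^ (S ∪ l.toFinset).card else 0 := by
  induction l generalizing S ψ with
  | nil => simpa using hψ
  | cons i l ih =>
    intro x
    have hi : i ∉ S := hS i (by simp)
    have e : S ∪ (i :: l).toFinset = insert i S ∪ l.toFinset := by
      ext j; simp
    rw [e, List.map_cons, List.foldl_cons]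
    refine ih (insert i S) _ (List.nodup_cons.mp hl).2 ?_ ?_ x
    · intro j hj
      rw [Finset.mem_insert, not_or]
      refine ⟨?_, hS j (by simp [hj])⟩
      rintro rfl
      exact (List.nodup_cons.mp hl).1 hj
    · intro y
      have h1 : ψ (Function.update y i true) = 0 := by
        rw [hψ, if_neg]
        intro h
        simpa using h i hi
      have h2 : (∀ j ∉ S, Function.update y i false j = false) ↔ ∀ j ∉ insert i S, y j = false := by
        constructor
        · intro h j hj
          rw [Finset.mem_insert, not_or] at hj
          have := h j hj.2
          rwa [Function.update_of_ne hj.1] at this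
        · intro h j hj
          by_cases hji : j = i
          · subst hji; simp
          · rw [Function.update_of_ne hji]
            exact h j (by simp [hji, hj])
      simp only [Gate.act, h1, mul_zero, add_zero]
      rw [hψ, Finset.card_insert_of_notMem hi]
      simp only [h2]
      split_ifs
      · rw [pow_succ, div_eq_mul_inv]
      · simp

theorem hadamards_measure (n : ℕ) :
    (hadamards n).measure = PMF.uniformOfFintype (Fin n → Bool) := by
  refine PMF.ext fun x => ?_
  have h := foldl_hadamard (List.finRange n).reverse ∅ (zeroState n)
    (by simpa using List.nodup_finRange n) (by simp) (fun x => by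
      simp only [zeroState, Finset.notMem_empty, not_false_eq_true, forall_true_left,
        Finset.card_empty, pow_zero, funext_iff]) x
  have huniv : ∅ ∪ (List.finRange n).reverse.toFinset = Finset.univ := by ext; simp
  rw [huniv, if_pos (by simp)] at h
  change ENNReal.ofReal (‖(hadamards n).finalState x‖ ^ 2) = _
  have h' : (hadamards n).finalState x = ((Real.sqrt 2 : ℂ)⁻¹) ^ n := by
    refine Eq.trans h ?_
    rw [Finset.card_univ, Fintype.card_fin]
  have hsq : ‖((Real.sqrt 2 : ℂ)⁻¹) ^ n‖ ^ 2 = ((2 : ℝ) ^ n)⁻¹ := by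
    rw [norm_pow, norm_inv, Complex.norm_real, Real.norm_eq_abs, ← pow_mul, mul_comm, pow_mul,
      inv_pow, sq_abs, Real.sq_sqrt (by norm_num), inv_pow]
  rw [h', hsq]
  refine Eq.trans ?_ (PMF.uniformOfFintype_apply x).symm
  rw [ENNReal.ofReal_inv_of_pos (by positivity)]
  congr 1
  rw [ENNReal.ofReal_pow (by norm_num)]
  simp
  rfl

/-- The gate list is built by a fold that adds gates at its head; this is why `hadamards` lists the
qubits in decreasing order. -/
theorem polyTime_hadamards : PolyTime (fun u : List Unit => hadamards u.length) := by
  let gate : List Unit → (Bool × Bool) × (List Unit × List Unit) :=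
    fun c => ((false, false), (c, []))
  let step : List Unit × List ((Bool × Bool) × (List Unit × List Unit)) → Unit →
      List Unit × List ((Bool × Bool) × (List Unit × List Unit)) :=
    fun s _ => (() :: s.1, gate s.1 :: s.2)
  have hgate : PolyTime gate := (PolyTime.const _).pair (PolyTime.id.pair (PolyTime.const _))
  have hstep : PolyTime (fun a : (List Unit × List ((Bool × Bool) × (List Unit × List Unit)))
      × Unit => step a.1 a.2) := by
    have h : PolyTime (fun s : List Unit × List ((Bool × Bool) × (List Unit × List Unit)) =>
        (() :: s.1, gate s.1 :: s.2)) :=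
      (PolyTime.cons.comp ((PolyTime.const ()).pair PolyTime.fst)).pair
        (PolyTime.cons.comp ((hgate.comp PolyTime.fst).pair PolyTime.snd))
    exact h.comp PolyTime.fst
  have hsize : ∀ (u : List Unit) s, codeSize (u.foldl step s)
      ≤ codeSize s + u.length * (u.length + codeSize s.1 + 6) := by
    intro u
    induction u with
    | nil => intro s; simp
    | cons d u ih =>
      intro s
      have h1 := ih (step s d)
      have h2 : codeSize (step s d) = codeSize s + codeSize s.1 + 5 := by
        obtain ⟨c, acc⟩ := s
        simp [step, gate]; omega
      have h3 : codeSize (step s d).1 = codeSize s.1 + 1 := by simp [step]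
      rw [List.foldl_cons, List.length_cons]
      rw [h2, h3] at h1
      nlinarith
  have hfold := PolyTime.foldl hstep
    (Polynomial.X + Polynomial.X * (Polynomial.X + 6)) fun s l k => by
      obtain ⟨c, acc⟩ := s
      have h1 := hsize (l.take k) (c, acc)
      have h2 : (l.take k).length * ((l.take k).length + codeSize c + 6) ≤
          codeSize (l, (c, acc)) * (codeSize (l, (c, acc)) + 6) := by
        have := length_lt_codeSize l
        simp only [codeSize_pair, List.length_take]
        exact Nat.mul_le_mul (by omega) (by omega)
      simp only [Polynomial.eval_add, Polynomial.eval_mul, Polynomial.eval_X,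
        Polynomial.eval_ofNat]
      have h3 : codeSize (c, acc) ≤ codeSize (l, (c, acc)) := by
        rw [codeSize_pair l]; omega
      simp only at h1
      omega
  have hval : ∀ (u c : List Unit) acc, u.foldl step (c, acc) =
      (List.replicate (u.length + c.length) (),
      ((List.range u.length).map (fun i => gate (List.replicate (i + c.length) ()))).reverse
        ++ acc) := by
    intro u
    induction u with
    | nil =>
      intro c acc
      exact Prod.ext (PolyTime.unit_ext (by simp)) (by simp)
    | cons d u ih =>
      intro c acc
      rw [List.foldl_cons, ih]
      refine Prod.ext (PolyTime.unit_ext (by simp; omega)) ?_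
      simp only [List.length_cons, List.range_succ_eq_map, List.map_cons, List.map_map,
        List.reverse_cons, List.append_assoc, List.cons_append, List.nil_append]
      congr 1
      · congr 2
        funext i
        simp only [Function.comp]
        congr 2
        omega
      · congr 2
        exact PolyTime.unit_ext (by simp)
  have h3 : PolyTime (fun u : List Unit => (u.foldl step ([], []))) :=
    hfold.comp (PolyTime.id.pair (PolyTime.const _))
  refine h3.congr_enc fun u => ?_
  have e : Circuit.data (hadamards u.length) = u.foldl step ([], []) := by
    rw [hval]
    simp only [Circuit.data, hadamards, List.length_nil, add_zero, List.append_nil, List.map_map]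
    refine Prod.ext rfl ?_
    simp only [List.map_reverse]
    congr 1
    rw [← List.map_coe_finRange_eq_range, List.map_map]
    rfl
  rw [← e]
  rfl

theorem IsClassicalAlgorithm.isQuantumAlgorithm {A : α → PMF β} (hA : IsClassicalAlgorithm A) :
    IsQuantumAlgorithm A := by
  obtain ⟨q, g, hg, hA⟩ := hA
  have hC : PolyTime (fun a : α => hadamards (q.eval (codeSize a))) :=
    (polyTime_hadamards.comp ((PolyTime.unaryEval q).comp PolyTime.unarySize)).congr fun a => by
      simp
  refine ⟨_, g, hC, hg, fun a => ?_⟩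
  rw [hA, hadamards_measure]
  rfl

theorem BPP_subset_BQP : BPP ⊆ BQP := fun _ ⟨A, hA, h⟩ => ⟨A, hA.isQuantumAlgorithm, h⟩

/-! ## Countability -/

theorem BitCode.enc_injective : Function.Injective (enc : α → List Bool) := fun a b h =>
  (cancel a b [] [] (by rw [h])).1

/-- An injective numbering of the programs. -/
def Prog.number : Prog → ℕ
  | push v b => Nat.pair 0 (Nat.pair v b.toNat)
  | pop v => Nat.pair 1 v
  | seq p q => Nat.pair 2 (Nat.pair p.number q.number)
  | branch v p q r => Nat.pair 3 (Nat.pair v (Nat.pair p.number (Nat.pair q.number r.number)))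
  | loop v p => Nat.pair 4 (Nat.pair v p.number)

theorem Prog.number_injective : Function.Injective Prog.number := by
  intro p
  induction p with
  | push v b =>
    intro q h
    cases q <;> simp only [number, Nat.pair_eq_pair] at h <;> simp at h
    obtain ⟨rfl, h⟩ := h
    rename_i c
    cases b <;> cases c <;> simp at h ⊢
  | pop v =>
    intro q h
    cases q <;> simp only [number, Nat.pair_eq_pair] at h <;> simp at h
    rw [h]
  | seq p q ihp ihq =>
    intro r h
    cases r <;> simp only [number, Nat.pair_eq_pair] at h <;> simp at h
    rw [ihp h.1, ihq h.2]
  | branch v p q r ihp ihq ihr =>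
    intro s h
    cases s <;> simp only [number, Nat.pair_eq_pair] at h <;> simp at h
    rw [h.1, ihp h.2.1, ihq h.2.2.1, ihr h.2.2.2]
  | loop v p ih =>
    intro q h
    cases q <;> simp only [number, Nat.pair_eq_pair] at h <;> simp at h
    rw [h.1, ih h.2]

instance : Countable Prog := Prog.number_injective.countable

/-- A chosen program determines its function: the halting store is unique, and codes are injective.
-/
theorem countable_polyTime : {g : α → β | PolyTime g}.Countable := by
  have : Nonempty Prog := ⟨.skip⟩
  choose! p hp using fun (g : α → β) (h : PolyTime g) => h
  refine Set.MapsTo.countable_of_injOn (f := p) (t := Set.univ) (fun _ _ => Set.mem_univ _) ?_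
    (Set.countable_univ)
  intro g hg g' hg' h
  obtain ⟨P, hP⟩ := hp g hg
  obtain ⟨P', hP'⟩ := hp g' hg'
  funext a
  obtain ⟨s, t, e, hs, -⟩ := hP a
  obtain ⟨s', t', e', hs', -⟩ := hP' a
  rw [h] at e
  obtain ⟨rfl, -⟩ := e.deterministic e'
  exact BitCode.enc_injective (hs.symm.trans hs')

theorem countable_quantumAlgorithms : {A : α → PMF β | IsQuantumAlgorithm A}.Countable := by
  refine ((countable_polyTime (α := α) (β := Circuit)).prod
    (countable_polyTime (α := α × List Bool) (β := β)) |>.image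
    (fun x a => (x.1 a).measure.map (fun r => x.2 (a, List.ofFn r)))).mono ?_
  rintro A ⟨C, g, hC, hg, hA⟩
  exact ⟨(C, g), ⟨hC, hg⟩, (funext hA).symm⟩

end

/-! ## Rational numbers -/

/-- The components of the code of a rational number. -/
def ratBits (v : ℚ) : Bool × (List Bool × List Bool) :=
  (decide (v.num < 0), (v.num.natAbs.bits, v.den.bits))

/-- Both codes are the same concatenation, bracketed differently, so sign, numerator and denominator
are accessible at no cost. -/
theorem enc_ratBits (v : ℚ) : enc (ratBits v) = enc v := (List.append_assoc _ _ _).symm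

theorem codeSize_ratBits (v : ℚ) : codeSize (ratBits v) = codeSize v := by
  unfold codeSize
  rw [enc_ratBits]

theorem polyTime_ratBits : PolyTime ratBits := .of_enc_eq enc_ratBits

/-- Zero, recognized by its empty numerator, is the exception: its sign bit must not be flipped. -/
theorem ratBits_neg (v : ℚ) : ratBits (-v) =
    if (ratBits v).2.1.isEmpty then ratBits v else (!(ratBits v).1, (ratBits v).2) := by
  simp only [ratBits, Rat.neg_num, Rat.neg_den, Int.natAbs_neg, List.isEmpty_iff]
  have h : v.num.natAbs.bits = [] ↔ v.num = 0 := by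
    rw [← List.length_eq_zero_iff, Nat.size_eq_bits_len, Nat.size_eq_zero, Int.natAbs_eq_zero]
  split_ifs with h0
  · rw [h] at h0; simp [h0]
  · rw [h] at h0
    refine Prod.ext ?_ rfl
    rw [← decide_not]
    exact decide_eq_decide.mpr (by omega)

theorem polyTime_neg : PolyTime (fun v : ℚ => -v) := by
  have h : PolyTime (fun x : Bool × (List Bool × List Bool) =>
      if x.2.1.isEmpty then x else (!x.1, x.2)) :=
    .ite (.comp .isEmpty (.comp .fst .snd)) .id (.pair (.not .fst) .snd)
  refine (h.comp polyTime_ratBits).congr_enc fun v => ?_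
  rw [← enc_ratBits, ratBits_neg]

theorem polyTime_isNeg : PolyTime (fun v : ℚ => (ratBits v).1) := .comp .fst polyTime_ratBits

theorem codeSize_neg (v : ℚ) : codeSize (-v) = codeSize v := by
  rw [← codeSize_ratBits, ← codeSize_ratBits v, ratBits_neg]
  split_ifs
  · rfl
  · rw [codeSize_prod, codeSize_prod (ratBits v)]
    simp

theorem bits_two_pow (n : ℕ) : (2 ^ n : ℕ).bits = List.replicate n false ++ [true] := by
  induction n with
  | zero => simp
  | succ n ih =>
    have : (2 ^ (n + 1) : ℕ) = Nat.bit false (2 ^ n) := by rw [Nat.bit_false]; ring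
    rw [this, Nat.bits_append_bit _ _ (fun h => absurd h (by positivity)), ih]
    rfl

theorem ratBits_two_pow (n : ℕ) :
    ratBits ((2 : ℚ) ^ n) = (false, (List.replicate n false ++ [true], [true])) := by
  have h1 : ((2 : ℚ) ^ n).num = 2 ^ n := by simp [Rat.num_pow]
  have h2 : ((2 : ℚ) ^ n).den = 1 := by simp [Rat.den_pow]
  have h3 : (2 ^ n : ℤ).natAbs = 2 ^ n := by simp [Int.natAbs_pow]
  rw [ratBits, h1, h2, h3, bits_two_pow]
  simp

theorem polyTime_two_pow : PolyTime (fun u : List Unit => (2 : ℚ) ^ u.length) := by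
  have h : PolyTime (fun u : List Unit =>
      (false, (u.map (fun _ => false) ++ [true], [true]))) :=
    .pair (.const _) (.pair (.comp .append (.pair (.map (.const _)) (.const _))) (.const _))
  refine h.congr_enc fun u => ?_
  rw [← enc_ratBits, ratBits_two_pow, List.map_const']

theorem codeSize_two_pow (n : ℕ) : codeSize ((2 : ℚ) ^ n) = 2 * n + 7 := by
  rw [← codeSize_ratBits, ratBits_two_pow]
  simp [codeSize_listBool]
  omega

/-- A rational number that is at least `2 ^ (J + 2)` in absolute value, or less than `2 ^ (J + 1)`,
is recognized by the lengths of its numerator and its denominator. -/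
def bitTest (J : ℕ) (v : ℚ) : Bool :=
  decide (((ratBits v).2.2 ++ List.replicate (J + 2) true).length ≤ (ratBits v).2.1.length)

theorem polyTime_bitTest (J : ℕ) : PolyTime (bitTest J) := by
  have h : PolyTime (fun x : Bool × (List Bool × List Bool) =>
      (x.2.2 ++ List.replicate (J + 2) true, x.2.1)) :=
    .pair (.comp .append (.pair (.comp .snd .snd) (.const _))) (.comp .fst .snd)
  have h2 := PolyTime.lengthLe.comp (h.comp polyTime_ratBits)
  exact h2

theorem natAbs_num_eq (v : ℚ) : ((v.num.natAbs : ℕ) : ℚ) = |v| * v.den := by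
  rw [Nat.cast_natAbs, Int.cast_abs, ← abs_of_pos (show (0 : ℚ) < v.den by exact_mod_cast v.den_pos),
    ← abs_mul, Rat.mul_den_eq_num]

/-- A positive integer with `s` bits lies in `[2 ^ (s - 1), 2 ^ s)`, so the two lengths locate `|v|`
only up to a factor of two on either side. Nothing is claimed between `2 ^ (J + 1)` and `2 ^ (J +
2)`; the gap of the target function bridges this range. -/
theorem bitTest_of_lt {J : ℕ} {v : ℚ} (h : |v| < 2 ^ (J + 1)) : bitTest J v = false := by
  simp only [bitTest, ratBits, List.length_append, List.length_replicate, decide_eq_false_iff_not,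
    not_le, Nat.size_eq_bits_len]
  have hd : (v.den : ℚ) < 2 ^ v.den.size := by exact_mod_cast Nat.lt_size_self v.den
  have hd0 : (0 : ℚ) < v.den := by exact_mod_cast v.den_pos
  have h1 : (v.num.natAbs : ℚ) < 2 ^ (v.den.size + J + 1) := by
    rw [natAbs_num_eq]
    calc |v| * v.den < 2 ^ (J + 1) * 2 ^ v.den.size :=
          mul_lt_mul'' h hd (abs_nonneg v) hd0.le
      _ = _ := by ring
  have h2 : v.num.natAbs < 2 ^ (v.den.size + J + 1) := by exact_mod_cast h1
  have := Nat.size_le.mpr h2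
  omega

theorem bitTest_of_ge {J : ℕ} {v : ℚ} (h : 2 ^ (J + 2) ≤ |v|) : bitTest J v = true := by
  simp only [bitTest, ratBits, List.length_append, List.length_replicate, decide_eq_true_eq,
    Nat.size_eq_bits_len]
  have hs : 0 < v.den.size := Nat.size_pos.mpr v.den_pos
  have hd : (2 : ℚ) ^ (v.den.size - 1) ≤ v.den := by
    exact_mod_cast Nat.lt_size.mp (by omega : v.den.size - 1 < v.den.size)
  have h1 : (2 : ℚ) ^ (v.den.size + J + 1) ≤ v.num.natAbs := by
    rw [natAbs_num_eq]
    calc (2 : ℚ) ^ (v.den.size + J + 1) = 2 ^ (J + 2) * 2 ^ (v.den.size - 1) := by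
          rw [← pow_add]; congr 1; omega
      _ ≤ _ := mul_le_mul h hd (by positivity) (abs_nonneg v)
  have h2 : 2 ^ (v.den.size + J + 1) ≤ v.num.natAbs := by exact_mod_cast h1
  have := Nat.lt_size.mpr h2
  omega

/-! ## The functions that separate the classes

A string is read as `1 ^ j 0 y`, with `j` ones in front and the body `y`. -/

/-- The string after the leading ones and one more bit. -/
def body (x : List Bool) : List Bool := (x.dropWhile (fun b => b)).tail

/-- The number of leading ones. -/
def leadingOnes (x : List Bool) : ℕ := x.length - (x.dropWhile (fun b => b)).length

/-- The first bit of the body. -/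
def tag (x : List Bool) : Bool := (body x).headD false

/-- The body without its first bit. -/
def payload (x : List Bool) : List Bool := (body x).tail

theorem polyTime_body : PolyTime body := by
  have h := PolyTime.tail.comp PolyTime.dropOnes
  exact h

theorem polyTime_tag : PolyTime tag := by
  have h := (PolyTime.headD false).comp polyTime_body
  exact h

theorem polyTime_payload : PolyTime payload := by
  have h := PolyTime.tail.comp polyTime_body
  exact h

theorem polyTime_leadingOnes :
    PolyTime (fun x : List Bool => List.replicate (leadingOnes x) ()) := by
  have h : PolyTime (fun x : List Bool => (List.replicate x.length ()).drop
      (List.replicate (x.dropWhile (fun b => b)).length ()).length) :=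
    .comp .drop (.pair (.comp .length .dropOnes) .length)
  exact h.congr fun x => PolyTime.unit_ext (by simp [leadingOnes])

theorem dropWhile_replicate_append (n : ℕ) (y : List Bool) :
    (List.replicate n true ++ false :: y).dropWhile (fun b => b) = false :: y := by
  induction n with
  | zero => simp
  | succ n ih => simp [List.replicate_succ]

theorem body_replicate (n : ℕ) (y : List Bool) :
    body (List.replicate n true ++ false :: y) = y := by
  rw [body, dropWhile_replicate_append, List.tail_cons]

theorem leadingOnes_replicate (n : ℕ) (y : List Bool) :
    leadingOnes (List.replicate n true ++ false :: y) = n := by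
  rw [leadingOnes, dropWhile_replicate_append]; simp

theorem leadingOnes_le (x : List Bool) : leadingOnes x ≤ x.length := Nat.sub_le _ _

theorem leadingOnes_ones (n : ℕ) : leadingOnes (List.replicate n true) = n := by
  have : (List.replicate n true).dropWhile (fun b => b) = [] := by
    simp
  rw [leadingOnes, this]; simp

theorem length_payload (x : List Bool) : (payload x).length ≤ x.length - 2 := by
  have h : (x.dropWhile (fun b => b)).length ≤ x.length := (List.dropWhile_sublist _).length_le
  rw [payload, body, List.length_tail, List.length_tail]
  omega

open Classical in
/-- `2 ^ j` or `4 ^ j`, according to whether the body belongs to `L`. -/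
noncomputable def gapFunction (L : Language Bool) (x : List Bool) : ℚ :=
  if body x ∈ L then 2 ^ (2 * leadingOnes x) else 2 ^ leadingOnes x

/-- Change the sign of `v` if `b` holds. -/
def applySign (b : Bool) (v : ℚ) : ℚ := if b then -v else v

/-- `gapFunction`, with a tag that may be inserted in front of the argument. -/
noncomputable def taggedGap (L : Language Bool) (x : List Bool) : ℚ := gapFunction L (payload x)

/-- `gapFunction`, with a sign that depends on the length of the argument. -/
noncomputable def signedGap (L : Language Bool) (h : ℕ → Bool) (x : List Bool) : ℚ :=
  applySign (h x.length) (gapFunction L x)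

theorem gapFunction_nil (L : Language Bool) : gapFunction L [] = 1 := by
  simp [gapFunction, leadingOnes]

theorem gapFunction_eq_pow (L : Language Bool) (x : List Bool) :
    ∃ k ≤ 2 * leadingOnes x, leadingOnes x ≤ k ∧ gapFunction L x = 2 ^ k := by
  unfold gapFunction
  split_ifs
  · exact ⟨_, le_rfl, by omega, rfl⟩
  · exact ⟨_, by omega, le_rfl, rfl⟩

theorem codeSize_gapFunction (L : Language Bool) (x : List Bool) :
    codeSize (gapFunction L x) ≤ 4 * x.length + 7 := by
  obtain ⟨k, hk, -, e⟩ := gapFunction_eq_pow L x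
  have := leadingOnes_le x
  rw [e, codeSize_two_pow]
  omega

theorem codeSize_applySign (b : Bool) (v : ℚ) : codeSize (applySign b v) = codeSize v := by
  cases b
  · rfl
  · exact codeSize_neg v

theorem polyTime_applySign : PolyTime (fun a : Bool × ℚ => applySign a.1 a.2) :=
  .boolCases .id polyTime_neg

theorem taggedGap_mem (L : Language Bool) : taggedGap L ∈ TargetFunctions := by
  refine ⟨4 * Polynomial.X + 7, fun x => ?_⟩
  have h1 := codeSize_gapFunction L (payload x)
  have h2 := length_payload x
  simp only [Polynomial.eval_add, Polynomial.eval_mul, Polynomial.eval_X, Polynomial.eval_ofNat]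
  unfold taggedGap
  omega

theorem signedGap_mem (L : Language Bool) (h : ℕ → Bool) : signedGap L h ∈ TargetFunctions := by
  refine ⟨4 * Polynomial.X + 7, fun x => ?_⟩
  simpa [signedGap, codeSize_applySign] using codeSize_gapFunction L x

/-- The value of `gapFunction` in terms of the answer to the question whether the body belongs to
the language. -/
def gapValue (x : List Bool) (b : Bool) : ℚ :=
  if b then 2 ^ (2 * leadingOnes x) else 2 ^ leadingOnes x

theorem gapValue_eq {L : Language Bool} {x : List Bool} {b : Bool} (h : b = true ↔ body x ∈ L) :
    gapValue x b = gapFunction L x := by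
  cases b
  · have h' : body x ∉ L := fun hx => by simpa using h.mpr hx
    simp [gapValue, gapFunction, h']
  · simp [gapValue, gapFunction, h.mp rfl]

theorem polyTime_gapValue : PolyTime (fun a : List Bool × Bool => gapValue a.1 a.2) := by
  have h1 : PolyTime (fun x : List Bool => (2 : ℚ) ^ leadingOnes x) :=
    (polyTime_two_pow.comp polyTime_leadingOnes).congr fun x => by simp
  have h2 : PolyTime (fun x : List Bool => (2 : ℚ) ^ (2 * leadingOnes x)) :=
    (polyTime_two_pow.comp (PolyTime.append.comp
      (polyTime_leadingOnes.pair polyTime_leadingOnes))).congr fun x => by simp [two_mul]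
  have h3 := PolyTime.ite (PolyTime.snd (α := List Bool) (β := Bool)) (h2.comp .fst)
    (h1.comp .fst)
  exact h3

/-! ### The unsigned function is as hard as the language. -/

theorem taggedGap_mem_quantumComputable {L : Language Bool} (hL : L ∈ BQP) :
    taggedGap L ∈ QuantumComputable (fun _ => (1 : ℝ)) := by
  obtain ⟨A, hA, δ, hδ, hd⟩ := hL
  have hpair : PolyTime (fun a : List Bool × Bool => (payload a.1, a.2)) :=
    (polyTime_payload.comp .fst).pair .snd
  have hψ := polyTime_gapValue.comp hpair
  have hq := hA.transform (polyTime_body.comp polyTime_payload) hψ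
  -- `Estimates` asks for a strict inequality, hence the midpoint of `δ` and `1/2`; the maximum
  -- supplies nonnegativity, which `DecidesWithBoundedError` does not state.
  refine ⟨taggedGap_mem L, _, hq, 1, max ((δ + 1 / 2) / 2) 0, one_pos, le_max_right _ _,
    max_lt (by linarith) (by norm_num), fun x => ?_⟩
  have h1 := hd (body (payload x))
  have h2 := le_max_left ((δ + 1 / 2) / 2) 0
  have h3 : {b | b = true ↔ body (payload x) ∈ L} ⊆
      (fun b => gapValue (payload x) b) ⁻¹'
        {y : ℚ | |(y : ℝ) - (taggedGap L x : ℝ)| < 1 * 1} := by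
    intro b hb
    have e : gapValue (payload x) b = taggedGap L x := gapValue_eq hb
    simp [e]
  have h4 := prob_mono (A (body (payload x))) h3
  rw [← prob_map] at h4
  exact lt_of_lt_of_le (by linarith) (h1.trans h4)

/-- Prefixing a constant number `K` of ones widens the gap beyond the fixed error `c`, and the
estimate then reveals whether `y ∈ L`. -/
theorem mem_BPP_of_taggedGap {L : Language Bool}
    (h : taggedGap L ∈ ClassicalComputable (fun _ => (1 : ℝ))) : L ∈ BPP := by
  obtain ⟨-, A, hA, c, δ, -, -, hδ, hd⟩ := h
  obtain ⟨J, hJ⟩ := pow_unbounded_of_one_lt c (one_lt_two (α := ℝ))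
  -- This makes `2 ^ K` at least `c` and at least `8`. Then `4 ^ K - c ≥ 2 ^ K * (2 ^ K - 1) ≥ 2 ^
  -- (K + 2)` and `2 ^ K + c ≤ 2 ^ (K + 1)`, the two cases of `bitTest K`.
  let K := J + 3
  have hK : c ≤ 2 ^ K := hJ.le.trans (pow_le_pow_right₀ one_le_two (by omega))
  -- The first `false` ends an empty run of ones and the second is an idle tag; the rest is the
  -- payload.
  let φ : List Bool → List Bool := fun y =>
    false :: false :: (List.replicate K true ++ false :: y)
  have hφ : PolyTime φ :=
    (PolyTime.append.comp (.pair (.const [false, false]) (PolyTime.append.comp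
      (.pair (.const (List.replicate K true)) (PolyTime.append.comp
        (.pair (.const [false]) .id)))))).congr fun y => by simp [φ]
  refine ⟨_, hA.transform (ψ := fun a => bitTest K a.2) hφ
    ((polyTime_bitTest K).comp .snd), δ, hδ, fun y => ?_⟩
  rw [prob_map]
  refine (hd (φ y)).le.trans (prob_mono _ fun v hv => ?_)
  have hpay : payload (φ y) = List.replicate K true ++ false :: y := by
    simp [φ, payload, body]
  have hval : taggedGap L (φ y) = gapFunction L (List.replicate K true ++ false :: y) := by
    rw [taggedGap, hpay]
  rw [Set.mem_ofPred_eq, hval, gapFunction, body_replicate, leadingOnes_replicate, mul_one] at hv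
  have hpos : (0 : ℝ) < 2 ^ K := by positivity
  have h8 : (2 : ℝ) ^ 3 ≤ 2 ^ K := pow_le_pow_right₀ one_le_two (by omega)
  simp only [Set.mem_preimage, Set.mem_ofPred_eq]
  by_cases hy : y ∈ L
  · simp only [hy, if_true, iff_true] at hv ⊢
    apply bitTest_of_ge
    have h1 := (abs_lt.mp hv).1
    push_cast at h1
    have h2 : (2 : ℝ) ^ (2 * K) = 2 ^ K * 2 ^ K := by rw [two_mul, pow_add]
    have h3 : (2 : ℝ) ^ (K + 2) ≤ (v : ℝ) := by
      rw [pow_add]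
      nlinarith
    have h4 : (2 : ℚ) ^ (K + 2) ≤ v := by exact_mod_cast h3
    exact h4.trans (le_abs_self v)
  · simp only [hy, if_false, iff_false] at hv ⊢
    rw [Bool.not_eq_true]
    apply bitTest_of_lt
    have h1 := abs_lt.mp hv
    push_cast at h1
    have h3 : |(v : ℝ)| < 2 ^ (K + 1) := by
      rw [pow_succ, abs_lt]
      constructor <;> linarith
    exact_mod_cast h3

/-! ## Uncomputable signs -/

theorem countable_eventuallyEq (h₀ : ℕ → Bool) :
    {h : ℕ → Bool | ∃ N, ∀ n, N ≤ n → h n = h₀ n}.Countable := by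
  have : {h : ℕ → Bool | ∃ N, ∀ n, N ≤ n → h n = h₀ n}
      = ⋃ N, {h : ℕ → Bool | ∀ n, N ≤ n → h n = h₀ n} := by
    ext h; simp
  rw [this]
  refine Set.countable_iUnion fun N => ?_
  refine Set.MapsTo.countable_of_injOn (f := fun h (i : Fin N) => h i) (t := Set.univ)
    (fun _ _ => Set.mem_univ _) ?_ Set.countable_univ
  intro h hh h' hh' e
  funext n
  by_cases hn : n < N
  · exact congrFun e ⟨n, hn⟩
  · rw [hh n (by omega), hh' n (by omega)]

/-- On the string of `n` ones the targets are `±2 ^ k` with `k ≥ n`. If the signs differed, an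
output close to both would force `2 * 2 ^ k < c + c'`, which is false for large `n`. -/
theorem eventuallyEq_of_estimates {L : Language Bool} {h h' : ℕ → Bool}
    {A : List Bool → PMF ℚ} (hA : Estimates A (fun _ => (1 : ℝ)) (signedGap L h))
    (hA' : Estimates A (fun _ => (1 : ℝ)) (signedGap L h')) :
    ∃ N, ∀ n, N ≤ n → h n = h' n := by
  obtain ⟨c, δ, -, -, hδ, hd⟩ := hA
  obtain ⟨c', δ', -, -, hδ', hd'⟩ := hA'
  obtain ⟨N, hN⟩ := exists_nat_gt (c + c')
  refine ⟨N, fun n hn => ?_⟩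
  obtain ⟨y, hy, hy'⟩ := inter_nonempty_of_prob (A (List.replicate n true))
    (lt_trans (by linarith) (hd _)) (lt_trans (by linarith) (hd' _))
  by_contra hne
  obtain ⟨k, -, hk, e⟩ := gapFunction_eq_pow L (List.replicate n true)
  rw [leadingOnes_ones] at hk
  simp only [Set.mem_ofPred_eq, signedGap, List.length_replicate, e, mul_one] at hy hy'
  have h1 : (n : ℝ) < 2 ^ k := by
    exact_mod_cast lt_of_lt_of_le (Nat.lt_two_pow_self) (Nat.pow_le_pow_right (by norm_num) hk)
  have h2 : (N : ℝ) ≤ n := by exact_mod_cast hn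
  have a1 := abs_lt.mp hy
  have a2 := abs_lt.mp hy'
  cases hb : h n <;> cases hb' : h' n <;> simp [hb, hb', applySign] at hne a1 a2 <;> linarith

/-- Otherwise the uncountable set of sign sequences would be a union, over countably many
algorithms, of sets of pairwise eventually equal sequences, and each of these is countable. -/
theorem exists_signedGap_notMem (L : Language Bool) :
    ∃ h : ℕ → Bool, signedGap L h ∉ QuantumComputable (fun _ => (1 : ℝ)) := by
  by_contra! hall
  have hcount : (Set.univ : Set (ℕ → Bool)).Countable := by
    have hsub : (Set.univ : Set (ℕ → Bool)) ⊆
        ⋃ A ∈ {A : List Bool → PMF ℚ | IsQuantumAlgorithm A},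
          {h | Estimates A (fun _ => (1 : ℝ)) (signedGap L h)} := by
      intro h _
      obtain ⟨-, A, hA, hE⟩ := hall h
      simp only [Set.mem_iUnion]
      exact ⟨A, hA, hE⟩
    refine (Set.Countable.biUnion countable_quantumAlgorithms fun A _ => ?_).mono hsub
    rcases Set.eq_empty_or_nonempty
      {h | Estimates A (fun _ => (1 : ℝ)) (signedGap L h)} with h0 | ⟨h₀, h0⟩
    · rw [h0]; exact Set.countable_empty
    · exact (countable_eventuallyEq h₀).mono fun h hh => eventuallyEq_of_estimates hh h0
  have := Set.countable_univ_iff.mp hcount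
  obtain ⟨f, hf⟩ := exists_surjective_nat (ℕ → Bool)
  obtain ⟨n, hn⟩ := hf fun n => !f n n
  simpa using congrFun hn n

/-! ## Samples -/

section
variable {α β γ : Type}

/-- Pointwise domination controls a small change of the sampling distribution: it passes through
`bind`, becomes the factor `r ^ n` for `n` samples, and bounds the loss of success probability. -/
theorem prob_mono_of_smul_le {P P' : PMF α} {r : ENNReal}
    (h : ∀ a, r * P a ≤ P' a) (S : Set α) : r.toReal * prob P S ≤ prob P' S := by
  have hS : r * P.toOuterMeasure S ≤ P'.toOuterMeasure S := by
    rw [PMF.toOuterMeasure_apply, PMF.toOuterMeasure_apply, ← ENNReal.tsum_mul_left]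
    refine ENNReal.tsum_le_tsum fun a => ?_
    by_cases ha : a ∈ S
    · simpa [ha] using h a
    · simp [ha]
  rw [prob, ← ENNReal.toReal_mul]
  exact ENNReal.toReal_mono
    (ne_top_of_le_ne_top ENNReal.one_ne_top (toOuterMeasure_le_one P' S)) hS

theorem smul_bind_le {P P' : PMF α} {f f' : α → PMF β} {r s : ENNReal}
    (h : ∀ a, r * P a ≤ P' a) (h' : ∀ a b, s * f a b ≤ f' a b) (b : β) :
    r * s * P.bind f b ≤ P'.bind f' b := by
  rw [PMF.bind_apply, PMF.bind_apply, ← ENNReal.tsum_mul_left]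
  refine ENNReal.tsum_le_tsum fun a => ?_
  calc r * s * (P a * f a b) = (r * P a) * (s * f a b) := by ring
    _ ≤ _ := mul_le_mul' (h a) (h' a b)

theorem smul_map_le {P P' : PMF α} (f : α → β) {r : ENNReal}
    (h : ∀ a, r * P a ≤ P' a) (b : β) : r * P.map f b ≤ P'.map f b := by
  have := smul_bind_le (f := PMF.pure ∘ f) (f' := PMF.pure ∘ f) (s := 1) h (by simp) b
  rwa [mul_one] at this

theorem smul_iidSample_le {D D' : PMF (List Bool)} {r : ENNReal} (h : ∀ x, r * D x ≤ D' x)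
    (n : ℕ) : ∀ l, r ^ n * iidSample D n l ≤ iidSample D' n l := by
  induction n with
  | zero => intro l; rw [pow_zero, one_mul]; rfl
  | succ n ih =>
    intro l
    rw [pow_succ', iidSample, iidSample]
    exact smul_bind_le h (fun x => smul_map_le _ ih) l

theorem prob_forall_mem_iidSample (D : PMF (List Bool)) (G : Set (List Bool)) (n : ℕ) :
    (iidSample D n).toOuterMeasure {l | ∀ x ∈ l, x ∈ G} = D.toOuterMeasure G ^ n := by
  induction n with
  | zero => simp [iidSample, PMF.toOuterMeasure_pure_apply]
  | succ n ih =>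
    rw [iidSample, PMF.toOuterMeasure_bind_apply, pow_succ',
      PMF.toOuterMeasure_apply D, ← ENNReal.tsum_mul_right]
    refine tsum_congr fun x => ?_
    rw [PMF.toOuterMeasure_map_apply]
    by_cases hx : x ∈ G
    · have : (fun l => x :: l) ⁻¹' {l | ∀ y ∈ l, y ∈ G} = {l | ∀ y ∈ l, y ∈ G} := by
        ext l; simp [hx]
      rw [this, ih, Set.indicator_of_mem hx, PMF.toOuterMeasure_apply]
    · have : (fun l => x :: l) ⁻¹' {l | ∀ y ∈ l, y ∈ G} = ∅ := by
        ext l; simp [hx]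
      rw [this]
      simp [hx]

theorem mem_support_iidSample (D : PMF (List Bool)) (n : ℕ) :
    ∀ l ∈ (iidSample D n).support, l.length = n ∧ ∀ x ∈ l, x ∈ D.support := by
  induction n with
  | zero => intro l hl; simp [iidSample] at hl; simp [hl]
  | succ n ih =>
    intro l hl
    rw [iidSample, PMF.mem_support_bind_iff] at hl
    obtain ⟨x, hx, hl⟩ := hl
    rw [PMF.mem_support_map_iff] at hl
    obtain ⟨l', hl', rfl⟩ := hl
    obtain ⟨h1, h2⟩ := ih l' hl'
    refine ⟨by simp [h1], ?_⟩
    intro y hy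
    rcases List.mem_cons.mp hy with rfl | hy
    · exact hx
    · exact h2 y hy

theorem iidSample_map (D : PMF (List Bool)) (g : List Bool → List Bool) (n : ℕ) :
    iidSample (D.map g) n = (iidSample D n).map (List.map g) := by
  induction n with
  | zero => simp [iidSample, PMF.pure_map]
  | succ n ih =>
    rw [iidSample, iidSample, ih, PMF.bind_map, PMF.map_bind]
    congr 1
    funext x
    simp only [Function.comp, PMF.map_comp]
    rfl

theorem iidSample_map_take (D : PMF (List Bool)) {k n : ℕ} (h : k ≤ n) :
    (iidSample D n).map (List.take k) = iidSample D k := by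
  induction n generalizing k with
  | zero =>
    obtain rfl : k = 0 := by omega
    simp [iidSample, PMF.pure_map]
  | succ n ih =>
    cases k with
    | zero =>
      have : (List.take 0 : List (List Bool) → _) = Function.const _ [] := by funext l; simp
      rw [this, PMF.map_const]
      rfl
    | succ k =>
      rw [iidSample, iidSample, PMF.map_bind]
      congr 1
      funext x
      rw [← ih (by omega : k ≤ n), PMF.map_comp, PMF.map_comp]
      rfl

theorem bind_congr_support (P : PMF α) {f g : α → PMF β} (h : ∀ a ∈ P.support, f a = g a) :
    P.bind f = P.bind g := by
  ext b
  rw [PMF.bind_apply, PMF.bind_apply]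
  refine tsum_congr fun a => ?_
  by_cases ha : P a = 0
  · simp [ha]
  · rw [h a ((PMF.mem_support_iff _ _).mpr ha)]

/-- A mixture in which the second law has weight `1 / (N + 1)`. -/
noncomputable def mixture (N : ℕ) (P Q : PMF α) : PMF α :=
  (PMF.uniformOfFintype (Fin (N + 1))).bind fun k => if k = 0 then Q else P

theorem smul_le_mixture (N : ℕ) (P Q : PMF α) (a : α) :
    (N * (N + 1 : ENNReal)⁻¹) * P a ≤ mixture N P Q a := by
  rw [mixture, PMF.bind_apply, tsum_fintype, Fin.sum_univ_succ]
  simp [mul_assoc]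

theorem support_mixture (N : ℕ) (hN : 0 < N) (P Q : PMF α) :
    (mixture N P Q).support = P.support ∪ Q.support := by
  ext a
  rw [mixture, PMF.mem_support_bind_iff]
  constructor
  · rintro ⟨k, -, h⟩
    split_ifs at h
    · exact Or.inr h
    · exact Or.inl h
  · rintro (h | h)
    · refine ⟨⟨1, by omega⟩, by simp, ?_⟩
      rw [if_neg (by simp [Fin.ext_iff])]
      exact h
    · exact ⟨0, by simp, by simpa using h⟩

end

/-- A uniformly distributed length of at most `m`, then a uniformly distributed string of this
length. -/
noncomputable def lengthUniform (m : ℕ) : PMF (List Bool) :=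
  (PMF.uniformOfFintype (Fin (m + 1))).bind fun k =>
    (PMF.uniformOfFintype (Fin k → Bool)).map List.ofFn

theorem support_lengthUniform (m : ℕ) : (lengthUniform m).support = {x | x.length ≤ m} := by
  ext x
  rw [lengthUniform, PMF.mem_support_bind_iff]
  constructor
  · rintro ⟨k, -, h⟩
    rw [PMF.mem_support_map_iff] at h
    obtain ⟨r, -, rfl⟩ := h
    have := k.2
    simp
    omega
  · intro hx
    refine ⟨⟨x.length, Nat.lt_succ_of_le hx⟩, by simp, ?_⟩
    rw [PMF.mem_support_map_iff]
    exact ⟨fun i => x[i], by simp, by simp⟩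

/-- Drawing the length first prevents short strings from being exponentially rare, so polynomially
many samples suffice to meet any given length. -/
theorem prob_lengthUniform {m k : ℕ} (hk : k ≤ m) :
    ((m : ℝ) + 1)⁻¹ ≤ prob (lengthUniform m) {x | x.length = k} := by
  have h := prob_bind_ge (PMF.uniformOfFintype (Fin (m + 1)))
    (fun k => (PMF.uniformOfFintype (Fin k → Bool)).map List.ofFn) {⟨k, Nat.lt_succ_of_le hk⟩}
    {x | x.length = k} (x := 1) (by
      rintro _ rfl
      have : List.ofFn ⁻¹' {x : List Bool | x.length = k}
          = (Set.univ : Set (Fin k → Bool)) := by ext; simp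
      rw [prob_map, this, ← Set.compl_empty, prob_compl]
      simp [prob])
  refine le_trans (le_of_eq ?_) h
  rw [mul_one, prob, PMF.toOuterMeasure_apply_singleton, PMF.uniformOfFintype_apply,
    Fintype.card_fin, ENNReal.toReal_inv, ENNReal.toReal_natCast]
  push_cast
  rfl

/-! ## Learning with signs read off the training set -/

/-- The sign of the values in `T` at the strings as long as `x`. -/
def readSign (x : List Bool) (T : List (List Bool × ℚ)) : Bool :=
  T.foldl (fun s e => if decide (e.1.length = x.length) then (ratBits e.2).1 else s) false

/-- The fold lemma admits no parameter, so `x` travels unchanged in the state. -/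
theorem polyTime_readSign :
    PolyTime (fun a : List Bool × List (List Bool × ℚ) => readSign a.1 a.2) := by
  let step : List Bool × Bool → List Bool × ℚ → List Bool × Bool := fun s e =>
    (s.1, if decide (e.1.length = s.1.length) then (ratBits e.2).1 else s.2)
  have hstep : PolyTime (fun a : (List Bool × Bool) × (List Bool × ℚ) => step a.1 a.2) := by
    have h1 : PolyTime (fun a : (List Bool × Bool) × (List Bool × ℚ) => (a.2.1, a.1.1)) :=
      .pair (.comp .fst .snd) (.comp .fst .fst)
    have h2 : PolyTime (fun a : (List Bool × Bool) × (List Bool × ℚ) => a.2.2) :=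
      .comp .snd .snd
    exact .pair (.comp .fst .fst)
      (.ite (PolyTime.lengthEq.comp h1) (polyTime_isNeg.comp h2) (.comp .snd .fst))
  have hfold := PolyTime.foldl_of_le hstep 0 fun s d => by simp [step, codeSize_prod]
  have hin : PolyTime (fun a : List Bool × List (List Bool × ℚ) => (a.2, (a.1, false))) :=
    .pair .snd (.pair .fst (.const _))
  refine (PolyTime.snd.comp (hfold.comp hin)).congr fun a => ?_
  have key : ∀ (T : List (List Bool × ℚ)) (x : List Bool) (s : Bool),
      T.foldl step (x, s) = (x, T.foldl
        (fun s e => if decide (e.1.length = x.length) then (ratBits e.2).1 else s) s) := by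
    intro T
    induction T with
    | nil => intro x s; rfl
    | cons e T ih => intro x s; exact ih x _
  simp only [key]
  rfl

theorem ratBits_applySign (L : Language Bool) (b : Bool) (x : List Bool) :
    (ratBits (applySign b (gapFunction L x))).1 = b := by
  obtain ⟨k, -, -, e⟩ := gapFunction_eq_pow L x
  have h := ratBits_two_pow k
  rw [e]
  cases b
  · rw [applySign, if_neg (by simp), h]
  · rw [applySign, if_pos rfl, ratBits_neg, h]
    simp

theorem readSign_eq (L : Language Bool) (h : ℕ → Bool) (x : List Bool) (l : List (List Bool))
    (hl : ∃ y ∈ l, y.length = x.length) :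
    readSign x (l.map fun y => (y, signedGap L h y)) = h x.length := by
  -- The invariant: the current bit is right, or a sample of the right length is still to come.
  -- Later such samples write the same bit again.
  have key : ∀ (l : List (List Bool)) (s : Bool),
      (s = h x.length ∨ ∃ y ∈ l, y.length = x.length) →
      (l.map fun y => (y, signedGap L h y)).foldl
        (fun s e => if decide (e.1.length = x.length) then (ratBits e.2).1 else s) s
        = h x.length := by
    intro l
    induction l with
    | nil => intro s hs; simpa using hs
    | cons y l ih =>
      intro s hs
      rw [List.map_cons, List.foldl_cons]
      refine ih _ ?_
      by_cases hy : y.length = x.length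
      · left
        simp [hy, signedGap, ratBits_applySign]
      · simpa [hy] using hs
  exact key l false (Or.inr hl)

/-- The procedure does not know `h`; the sign comes from a sample of the same length as `x`, the
absolute value from the quantum decision of `L`. -/
theorem signedGap_mem_quantumLearnable {L : Language Bool} (hL : L ∈ BQP) (h : ℕ → Bool) :
    signedGap L h ∈ QuantumLearnable (fun _ => (1 : ℝ)) := by
  obtain ⟨A, hA, δ₀, hδ₀, hd₀⟩ := hL
  obtain ⟨δ, hδ0, hδ, hd⟩ : ∃ δ : ℝ, 0 ≤ δ ∧ δ < 1 / 2 ∧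
      ∀ x, 1 - δ ≤ prob (A x) {b | b = true ↔ x ∈ L} :=
    ⟨max δ₀ 0, le_max_right _ _, max_lt hδ₀ (by norm_num), fun x => by
      have := le_max_left δ₀ 0
      linarith [hd₀ x]⟩
  have hφ : PolyTime (fun a : List Bool × List (List Bool × ℚ) => body a.1) :=
    polyTime_body.comp .fst
  have hsign : PolyTime (fun a : (List Bool × List (List Bool × ℚ)) × Bool =>
      (readSign a.1.1 a.1.2, gapValue a.1.1 a.2)) := by
    have h1 : PolyTime (fun a : (List Bool × List (List Bool × ℚ)) × Bool => (a.1.1, a.2)) :=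
      .pair (.comp .fst .fst) .snd
    exact (polyTime_readSign.comp .fst).pair (polyTime_gapValue.comp h1)
  have hM := hA.transform hφ (polyTime_applySign.comp hsign)
  set ε : ℝ := (1 / 2 - δ) / 2 with hε
  have hε0 : 0 < ε := by rw [hε]; linarith
  obtain ⟨K, hK⟩ := exists_nat_gt (-Real.log ε)
  have hKε : Real.exp (-K) ≤ ε := by
    rw [← Real.exp_log hε0]
    exact Real.exp_le_exp.mpr (by linarith)
  -- With `K * (m + 1)` samples a given length is missed with probability at most `(1 - 1/(m+1)) ^
  -- (K * (m + 1)) ≤ exp (-K) ≤ ε`. The additional `ε / 2` makes the final inequality strict, and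
  -- the sum stays below `1/2`.
  refine ⟨signedGap_mem L h, _, hM, lengthUniform, Polynomial.C K * (Polynomial.X + 1), 1,
    δ + ε + ε / 2, fun m _ => support_lengthUniform m, one_pos, by linarith, by linarith,
    fun m hm x hx => ?_⟩
  rw [support_lengthUniform] at hx
  set n := (Polynomial.C K * (Polynomial.X + 1)).eval m with hn
  have hn' : n = K * (m + 1) := by simp [hn]
  have hmiss : prob (iidSample (lengthUniform m) n) {l | ∀ y ∈ l, y ∈ {y | y.length = x.length}ᶜ}
      ≤ ε := by
    rw [prob, prob_forall_mem_iidSample, ENNReal.toReal_pow]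
    change prob (lengthUniform m) _ ^ n ≤ ε
    have h1 := prob_lengthUniform (m := m) (k := x.length) hx
    have hm1 : (0 : ℝ) < m + 1 := by positivity
    refine le_trans ?_ hKε
    calc prob (lengthUniform m) {y | y.length = x.length}ᶜ ^ n
        ≤ (Real.exp (-((m : ℝ) + 1)⁻¹)) ^ n := by
          refine pow_le_pow_left₀ (prob_nonneg _ _) ?_ _
          rw [prob_compl]
          have := Real.add_one_le_exp (-((m : ℝ) + 1)⁻¹)
          linarith
      _ = Real.exp (-K) := by
          rw [← Real.exp_nat_mul, hn']
          congr 1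
          push_cast
          field_simp
  have hseen : 1 - ε ≤ prob (iidSample (lengthUniform m) n)
      {l | ∃ y ∈ l, y.length = x.length} := by
    have e : {l : List (List Bool) | ∀ y ∈ l, y ∈ {y | y.length = x.length}ᶜ}ᶜ
        = {l | ∃ y ∈ l, y.length = x.length} := by
      ext l; simp
    rw [← e, prob_compl]
    linarith
  rw [trainingSet, PMF.bind_map]
  have hb := prob_bind_ge (iidSample (lengthUniform m) n)
    (fun l => (A (body x)).map fun b =>
      applySign (readSign x (l.map fun y => (y, signedGap L h y))) (gapValue x b))
    {l | ∃ y ∈ l, y.length = x.length}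
    {y : ℚ | |(y : ℝ) - (signedGap L h x : ℝ)| < 1 * 1} (x := 1 - δ) (by
      intro l hl
      rw [prob_map]
      refine (hd (body x)).trans (prob_mono _ fun b hb => ?_)
      have e : applySign (readSign x (l.map fun y => (y, signedGap L h y))) (gapValue x b)
          = signedGap L h x := by
        rw [readSign_eq L h x l hl, gapValue_eq hb, signedGap]
      simp [e])
  refine lt_of_lt_of_le ?_ hb
  have : (1 - ε) * (1 - δ) ≤ prob (iidSample (lengthUniform m) n)
      {l | ∃ y ∈ l, y.length = x.length} * (1 - δ) :=
    mul_le_mul_of_nonneg_right hseen (by linarith)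
  nlinarith

/-! ## Tags carry the signs -/

/-- The absolute value, computed from the sign bit. -/
def ratAbs (v : ℚ) : ℚ := applySign (ratBits v).1 v

theorem ratAbs_eq (v : ℚ) : ratAbs v = |v| := by
  simp only [ratAbs, applySign, ratBits, decide_eq_true_eq, Rat.num_neg]
  split_ifs with hv
  · exact (abs_of_neg hv).symm
  · exact (abs_of_nonneg (not_lt.mp hv)).symm

theorem polyTime_ratAbs : PolyTime ratAbs := by
  have h := polyTime_applySign.comp (polyTime_isNeg.pair .id)
  exact h

theorem abs_signedGap (L : Language Bool) (h : ℕ → Bool) (x : List Bool) :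
    |signedGap L h x| = gapFunction L x := by
  obtain ⟨k, -, -, e⟩ := gapFunction_eq_pow L x
  have hpos : (0 : ℚ) < gapFunction L x := by rw [e]; positivity
  unfold signedGap applySign
  split_ifs
  · rw [abs_neg, abs_of_pos hpos]
  · exact abs_of_pos hpos

/-- The string of length `m` with payload `z` and tag `b`. -/
def pack (m : ℕ) (b : Bool) (z : List Bool) : List Bool :=
  List.replicate (m - 2 - z.length) true ++ false :: (b :: z)

theorem length_pack {m : ℕ} {b : Bool} {z : List Bool} (h : z.length + 2 ≤ m) :
    (pack m b z).length = m := by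
  simp [pack]; omega

theorem payload_pack (m : ℕ) (b : Bool) (z : List Bool) : payload (pack m b z) = z := by
  rw [payload, pack, body_replicate, List.tail_cons]

theorem tag_pack (m : ℕ) (b : Bool) (z : List Bool) : tag (pack m b z) = b := by
  rw [tag, pack, body_replicate, List.headD_cons]

/-- Turn a sample of `taggedGap` into a sample of `signedGap`. -/
def untag (e : List Bool × ℚ) : List Bool × ℚ := (payload e.1, applySign (tag e.1) e.2)

theorem polyTime_untag : PolyTime untag := by
  have h1 : PolyTime (fun e : List Bool × ℚ => (tag e.1, e.2)) := (polyTime_tag.comp .fst).pair .snd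
  have h2 := (polyTime_payload.comp .fst).pair (polyTime_applySign.comp h1)
  exact h2

/-- The input of a procedure that learns `signedGap` from `p.eval` samples, given an input of a
procedure that learns `taggedGap`. -/
def untagInput (p : Polynomial ℕ) (a : List Bool × List (List Bool × ℚ)) :
    List Bool × List (List Bool × ℚ) :=
  (payload a.1, (a.2.map untag).take (p.eval ((a.2.headD ([], 0)).1.length - 2)))

theorem polyTime_untagInput (p : Polynomial ℕ) : PolyTime (untagInput p) := by
  have h1 : PolyTime (fun a : List Bool × List (List Bool × ℚ) => (a.2.headD ([], 0)).1) :=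
    PolyTime.fst.comp ((PolyTime.headD _).comp .snd)
  have h2 := PolyTime.tail.comp (PolyTime.tail.comp h1)
  have h3 := (PolyTime.unaryEval p).comp (PolyTime.length.comp h2)
  have h4 := PolyTime.take.comp (h3.pair ((PolyTime.map polyTime_untag).comp .snd))
  refine ((polyTime_payload.comp .fst).pair h4).congr fun a => ?_
  simp [untagInput, Nat.sub_sub]

/-- Since `taggedGap` does not depend on the tag, the tag may carry `h`, and the sampling law may do
so even if `h` is uncomputable. Untagging such samples gives exactly a training set for `signedGap`,
and taking absolute values does not increase the error. -/
theorem taggedGap_mem_classicalLearnable {L : Language Bool} {h : ℕ → Bool}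
    (hc : signedGap L h ∈ ClassicalLearnable (fun _ => (1 : ℝ))) :
    taggedGap L ∈ ClassicalLearnable (fun _ => (1 : ℝ)) := by
  obtain ⟨-, M, hM, D, p, c, δ, hD, hc0, hδ0, hδ, hlearn⟩ := hc
  have hψ : PolyTime (fun a : (List Bool × List (List Bool × ℚ)) × ℚ =>
      if (payload a.1.1).isEmpty then 1 else ratAbs a.2) := by
    have h1 : PolyTime (fun a : (List Bool × List (List Bool × ℚ)) × ℚ => a.1.1) :=
      PolyTime.fst.comp .fst
    exact .ite (PolyTime.isEmpty.comp (polyTime_payload.comp h1)) (.const _)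
      (polyTime_ratAbs.comp .snd)
  have hM' := hM.transform (polyTime_untagInput p) hψ
  set κ : ℝ := (1 / 2 - δ) / 2 with hκ
  have hκ0 : 0 < κ := by rw [hκ]; linarith
  -- By Bernoulli's inequality, a sufficiently large weight of the tagged law costs only a factor `1
  -- - κ` over all `n` samples.
  have hN : ∀ n : ℕ, ∃ N : ℕ, 0 < N ∧ 1 - κ ≤ ((N : ℝ) * ((N : ℝ) + 1)⁻¹) ^ n := by
    intro n
    obtain ⟨N, hN⟩ := exists_nat_gt (n / κ)
    refine ⟨N + 1, by omega, ?_⟩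
    push_cast
    have hpos : (0 : ℝ) < (N : ℝ) + 1 + 1 := by positivity
    have e : ((N : ℝ) + 1) * ((N : ℝ) + 1 + 1)⁻¹ = 1 + -((N : ℝ) + 1 + 1)⁻¹ := by
      field_simp; ring
    have hinv : ((N : ℝ) + 1 + 1)⁻¹ ≤ 1 :=
      inv_le_one_of_one_le₀ (by linarith [N.cast_nonneg (α := ℝ)])
    have hb := one_add_mul_le_pow (a := -((N : ℝ) + 1 + 1)⁻¹) (by linarith) n
    rw [e]
    refine le_trans ?_ hb
    have : (n : ℝ) * ((N : ℝ) + 1 + 1)⁻¹ ≤ κ := by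
      rw [← div_eq_mul_inv, div_le_iff₀ hpos]
      rw [div_lt_iff₀ hκ0] at hN
      nlinarith
    linarith
  choose N hN0 hN using hN
  let E : ℕ → PMF (List Bool) := fun m =>
    (D (m - 2)).map fun z => pack m (h z.length) z
  -- The tagged law does not have full support; mixing in a little of `lengthUniform` repairs this.
  -- For `m ≤ 2` every payload is empty and no useful samples are needed.
  let D' : ℕ → PMF (List Bool) := fun m =>
    if 3 ≤ m then mixture (N (p.eval m + 1)) (E m) (lengthUniform m) else lengthUniform m
  have hD' : ∀ m, (D' m).support = {x | x.length ≤ m} := by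
    intro m
    by_cases hm : 3 ≤ m
    · simp only [D', if_pos hm]
      rw [support_mixture _ (hN0 _), support_lengthUniform]
      refine Set.union_eq_right.mpr ?_
      intro x hx
      rw [PMF.mem_support_map_iff] at hx
      obtain ⟨z, hz, rfl⟩ := hx
      rw [hD (m - 2) (by omega)] at hz
      have hz' : z.length ≤ m - 2 := hz
      exact (length_pack (by omega)).le
    · simp only [D', if_neg hm]
      exact support_lengthUniform m
  -- One sample more than `p` ensures a first sample. Under the tagged law its length is `m`, which
  -- tells the procedure to keep `p.eval (m - 2)` samples for the old learner.
  refine ⟨taggedGap_mem L, _, hM', D', p + 1, c, δ + κ, fun m _ => hD' m, hc0, by linarith,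
    by linarith, fun m hm x hx => ?_⟩
  rw [hD'] at hx
  have hxm : x.length ≤ m := hx
  -- Here the value is known to be `1`. A nonempty payload forces `3 ≤ m`, so that the old learner
  -- is used at an admissible index `m - 2 ≥ 1`.
  by_cases hz : payload x = []
  · have hconst : ∀ T, (M (untagInput p (x, T))).map (fun b =>
        if (payload x).isEmpty then (1 : ℚ) else ratAbs b) = PMF.pure 1 := by
      intro T
      have : (fun b => if (payload x).isEmpty then (1 : ℚ) else ratAbs b) = Function.const _ 1 := by
        funext b; simp [hz]
      rw [this, PMF.map_const]
    simp only [hconst]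
    rw [PMF.bind_const, prob_pure_of_mem]
    · linarith
    · simp [taggedGap, hz, gapFunction_nil, hc0]
  · have hlen := length_payload x
    have hpos : 0 < (payload x).length := List.length_pos_iff.mpr hz
    have hm3 : 3 ≤ m := by omega
    have hmem : payload x ∈ (D (m - 2)).support := by
      rw [hD (m - 2) (by omega)]
      change (payload x).length ≤ m - 2
      omega
    have hmain := hlearn (m - 2) (by omega) (payload x) hmem
    set n := p.eval m + 1 with hn
    have hn' : (p + 1).eval m = n := by simp [hn]
    have hid : ∀ T, (M (untagInput p (x, T))).map (fun b =>
        if (payload x).isEmpty then (1 : ℚ) else ratAbs b) = (M (untagInput p (x, T))).map ratAbs := by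
      intro T
      have : (fun b => if (payload x).isEmpty then (1 : ℚ) else ratAbs b) = ratAbs := by
        funext b; simp [hz]
      rw [this]
    simp only [hid]
    rw [hn', trainingSet, PMF.bind_map]
    set S : Set ℚ := {y : ℚ | |(y : ℝ) - (taggedGap L x : ℝ)| < c * 1} with hS
    set f : List (List Bool) → PMF ℚ := (fun T => (M (untagInput p (x, T))).map ratAbs) ∘
      fun l => l.map fun x => (x, taggedGap L x) with hf
    -- Under the purely tagged law, the new procedure has the law of the old one on a genuine
    -- training set, followed by the absolute value.
    have hgood : (iidSample (E m) n).bind f =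
        (trainingSet (signedGap L h) (D (m - 2)) (p.eval (m - 2))).bind
          fun T => (M (payload x, T)).map ratAbs := by
      have hle : p.eval (m - 2) ≤ n := (p.eval_mono_nat (by omega)).trans (Nat.le_succ _)
      rw [trainingSet, ← iidSample_map_take (D (m - 2)) hle]
      simp only [E]
      rw [iidSample_map, PMF.bind_map, PMF.bind_map, PMF.bind_map]
      refine bind_congr_support _ fun l hl => ?_
      obtain ⟨hl1, hl2⟩ := mem_support_iidSample _ _ l hl
      rw [hD (m - 2) (by omega)] at hl2
      have hhead : ((((l.map fun z => pack m (h z.length) z).map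
          fun x => (x, taggedGap L x)).headD ([], 0)).1).length = m := by
        rcases l with _ | ⟨z, l⟩
        · simp [hn] at hl1
        · have : z.length ≤ m - 2 := hl2 z (by simp)
          simpa using length_pack (by omega)
      have huntag : ((l.map fun z => pack m (h z.length) z).map
          fun x => (x, taggedGap L x)).map untag = l.map fun z => (z, signedGap L h z) := by
        rw [List.map_map, List.map_map]
        refine List.map_congr_left fun z _ => ?_
        simp only [Function.comp, untag, payload_pack, tag_pack, taggedGap, signedGap]
      simp only [Function.comp, hf, untagInput]
      rw [hhead, huntag, List.map_take]
    set r : ENNReal := (N n : ENNReal) * ((N n : ENNReal) + 1)⁻¹ with hr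
    have hr1 : r.toReal = (N n : ℝ) * ((N n : ℝ) + 1)⁻¹ := by
      rw [hr, ENNReal.toReal_mul, ENNReal.toReal_inv, ENNReal.toReal_add (by simp) (by simp)]
      simp
    have hdom : ∀ y, r * E m y ≤ D' m y := by
      intro y
      simp only [D', if_pos hm3]
      exact smul_le_mixture _ _ _ y
    have hbind := prob_mono_of_smul_le (r := r ^ n * 1)
      (smul_bind_le (smul_iidSample_le hdom n) (f := f) (f' := f) (s := 1) (by simp)) S
    rw [mul_one, ENNReal.toReal_pow, hr1, hgood] at hbind
    refine lt_of_lt_of_le ?_ hbind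
    have h1 := hN n
    have h2 : 1 - δ < prob ((trainingSet (signedGap L h) (D (m - 2)) (p.eval (m - 2))).bind
        fun T => (M (payload x, T)).map ratAbs) S := by
      rw [← PMF.map_bind, prob_map]
      refine hmain.trans_le (prob_mono _ fun v hv => ?_)
      have hv' : |(v : ℝ) - (signedGap L h (payload x) : ℝ)| < c * 1 := hv
      refine lt_of_le_of_lt ?_ hv'
      rw [ratAbs_eq, taggedGap, ← abs_signedGap L h, Rat.cast_abs, Rat.cast_abs]
      exact abs_abs_sub_abs_le _ _
    have h3 := mul_le_mul_of_nonneg_right h1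
      (prob_nonneg ((trainingSet (signedGap L h) (D (m - 2)) (p.eval (m - 2))).bind
        fun T => (M (payload x, T)).map ratAbs) S)
    have h4 := prob_le_one ((trainingSet (signedGap L h) (D (m - 2)) (p.eval (m - 2))).bind
        fun T => (M (payload x, T)).map ratAbs) S
    -- As the old success probability `q` is at most `1`, `(1 - κ) * q ≥ q - κ > 1 - δ - κ`.
    nlinarith

theorem proposition1 (hclass : BQP ≠ BPP) :
    QuantumLearnable (fun _ => (1 : ℝ)) \ ClassicalLearnable (fun _ => (1 : ℝ)) ≠
      QuantumComputable (fun _ => (1 : ℝ)) \ ClassicalComputable (fun _ => (1 : ℝ)) := by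
  obtain ⟨L, hL, hL'⟩ : ∃ L ∈ BQP, L ∉ BPP := by
    by_contra! h
    exact hclass (Set.Subset.antisymm h BPP_subset_BQP)
  obtain ⟨h, hh⟩ := exists_signedGap_notMem L
  intro heq
  have h1 : taggedGap L ∈ QuantumComputable (fun _ => (1 : ℝ)) \
      ClassicalComputable (fun _ => (1 : ℝ)) :=
    ⟨taggedGap_mem_quantumComputable hL, fun hc => hL' (mem_BPP_of_taggedGap hc)⟩
  -- The assumed equality is used in both directions: here it makes `taggedGap L` not classically
  -- learnable, and below it makes `signedGap L h` quantum computable.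
  rw [← heq] at h1
  have h2 : signedGap L h ∈ QuantumLearnable (fun _ => (1 : ℝ)) \
      ClassicalLearnable (fun _ => (1 : ℝ)) :=
    ⟨signedGap_mem_quantumLearnable hL h, fun hc => h1.2 (taggedGap_mem_classicalLearnable hc)⟩
  rw [heq] at h2
  exact hh h2.1
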